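/- **The graph.** For integers $n,r,s,t\ge 1$ let $G_{n,r,s,t}$ be the following acyclic directed multigraph with edge costs. Put $\epsilon=1/(rs)$. The vertices are the target $\mathsf t=u_{n+1}=w_{n+1}$ and, for $i\in[n]$, the vertices $u_i$, $w_i$, $a_{i,j,k}$ ($j\in[r]$, $k\in[s]$) and $b_{i,j}$ ($j\in[rs]$). For convenience write $a_{i,j,s+1}=b_{i,1}$ and $b_{i,rs+1}=w_{i+1}$. The edges are, for all $i\in[n]$: - *one-edges*, all of cost $0$: a single edge $a_{i,j,k}\to a_{i,j,k+1}$ for $j\in[r],k\in[s]$; a single edge $b_{i,j}\to b_{i,j+1}$ for $j\in[rs]$; $t$ parallel edges $u_i\to b_{i,1}$; $t$ parallel edges $w_i\to a_{i,j,1}$ for each $j\in[r]$; - *zero-edges*, each with $t$ parallel copies: $a_{i,j,k}\to u_{i+1}$ of cost $2^{2i+1}+(k-1)\epsilon$ for $j\in[r],k\in[s]$; $b_{i,j}\to u_{i+1}$ of cost $2^{2i+1}+1+(j-1)\epsilon$ for $j\in[rs]$; $u_i\to u_{i+1}$ of cost $2^{2i}$; $w_i\to w_{i+1}$ of cost $2^{2i}$.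 **The algorithm.** A *tree* $B$ consists of exactly one outgoing edge of every vertex other than $\mathsf t$, such that following these edges leads from every vertex to $\mathsf t$; $y_B(v)$ is the cost of the path from $v$ to $\mathsf t$ in $B$. An edge $e=(u,v)$ is an *improving switch* with respect to $B$ if $c(e)+y_B(v)<y_B(u)$, and $B[e]$ is obtained from $B$ by replacing its edge that leaves $u$ by $e$. $\text{Random-Facet}(F,B)$, for a set $F$ of edges and a tree $B\subseteq F$, does the following. If $F=B$, it returns $B$. Otherwise it picks $e\in F\setminus B$ uniformly at random and calls $\text{Random-Facet}(F\setminus\{e\},B)$, which returns a tree $B'$. If $e$ is an improving switch with respect to $B'$, it performs this switch and returns the result of $\text{Random-Facet}(F,B'[e])$; otherwise it returns $B'$. All random choices are independent. **Theorem.** Let $r,s,t:\mathbb N\to\mathbb N$ satisfy $r(n)=\Theta(\log n)$, $s(n)=\Theta(\sqrt n\,\log n)$ and $t(n)=\Theta(\log n)$, and let $E$ be the edge set of $G_{n,r(n),s(n),t(n)}$ and $M=|E|$. Then $\sqrt n=\Theta(M^{1/3}/\log M)$, and there is a constant $c>0$ such that for all sufficiently large $n$ and for every tree $B_0$ of $G_{n,r(n),s(n),t(n)}$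 that consists entirely of zero-edges, the expected number of improving switches performed by $\text{Random-Facet}(E,B_0)$ is at least $e^{c\sqrt n}$ and at least $e^{c\,M^{1/3}/\log M}$. -/

import Mathlib

open Filter Asymptotics
open scoped ENNReal

/-- A directed multigraph with vertices `V`, edges `E`, real edge costs and a target vertex:
an instance of the problem of finding shortest paths from all vertices to the target. -/
structure PathInstance (V E : Type) where
  src : E → V
  dst : E → V
  cost : E → ℝ
  target : V

namespace PathInstance

variable {V E : Type} (G : PathInstance V E)

/-- `G.PathCost B v x`: some path of edges of `B` leads from `v` to the target and has total
cost `x`. If `B` is a tree, then `x` is unique, and it is the value `y_B(v)`. -/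
inductive PathCost (B : Finset E) : V → ℝ → Prop
  | target : PathCost B G.target 0
  | step (e : E) (x : ℝ) : e ∈ B → PathCost B (G.dst e) x →
      PathCost B (G.src e) (G.cost e + x)

/-- `B` is a tree directed towards the target: exactly one edge of `B` leaves every vertex other
than the target, none leaves the target, and every vertex reaches the target inside `B`. -/
def IsTree (B : Finset E) : Prop :=
  (∀ v, v ≠ G.target → ∃! e, e ∈ B ∧ G.src e = v) ∧
  (∀ e ∈ B, G.src e ≠ G.target) ∧
  ∀ v, ∃ x, G.PathCost B v x

/-- The edge `e = (u, v)` is an improving switch with respect to `B`: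
`c(e) + y_B(v) < y_B(u)`. -/
def Improving (B : Finset E) (e : E) : Prop :=
  ∃ x y, G.PathCost B (G.src e) x ∧ G.PathCost B (G.dst e) y ∧ G.cost e + y < x

open Classical in
/-- `B[e]`: the edge of `B` that leaves the tail of `e` is replaced by `e`. -/
noncomputable def switch (B : Finset E) (e : E) : Finset E :=
  insert e (B.filter fun e' => G.src e' ≠ G.src e)

end PathInstance

/-- Binary computation trees. A node stands for a recursive call of Random-Facet; it is a leaf,
or it is labelled with the edge picked by the call and has either a left child only, or a left
and a right child. -/
inductive CompTree (E : Type) : Type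
  | leaf : CompTree E
  | left (e : E) (l : CompTree E) : CompTree E
  | both (e : E) (l r : CompTree E) : CompTree E

namespace CompTree

variable {V E : Type} (G : PathInstance V E)

/-- The number of nodes that have a right child, that is, of improving switches performed. -/
def numSwitches : CompTree E → ℕ
  | leaf => 0
  | left _ l => l.numSwitches
  | both _ l r => l.numSwitches + 1 + r.numSwitches

/-- The tree returned by a call with current tree `B` whose computation tree is given. -/
noncomputable def result : Finset E → CompTree E → Finset E
  | B, leaf => B
  | B, left _ l => result B l
  | B, both e l r => result (G.switch (result B l) e) r

/-- The given computation tree can be generated by the call `Random-Facet(F, B)`: if `F = B`, the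
call stops; otherwise it picks `e ∈ F \ B` and calls `Random-Facet(F \ {e}, B)`, which returns
`B'`; if `e` is an improving switch with respect to `B'`, then it calls
`Random-Facet(F, B'[e])`, otherwise it stops. -/
def IsRun [DecidableEq E] : Finset E → Finset E → CompTree E → Prop
  | F, B, leaf => F = B
  | F, B, left e l => e ∈ F \ B ∧ IsRun (F.erase e) B l ∧ ¬ G.Improving (result G B l) e
  | F, B, both e l r => e ∈ F \ B ∧ IsRun (F.erase e) B l ∧ G.Improving (result G B l) e ∧
      IsRun F (G.switch (result G B l) e) r

/-- The probability that `Random-Facet(F, B)` generates the given computation tree: every call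
picks its edge uniformly at random from `F \ B`, independently of all other choices. -/
noncomputable def prob [DecidableEq E] : Finset E → Finset E → CompTree E → ℝ≥0∞
  | _, _, leaf => 1
  | F, B, left e l => ((F \ B).card : ℝ≥0∞)⁻¹ * prob (F.erase e) B l
  | F, B, both e l r => ((F \ B).card : ℝ≥0∞)⁻¹ * prob (F.erase e) B l *
      prob F (G.switch (result G B l) e) r

end CompTree

/-- The expected number of improving switches performed by `Random-Facet(F, B)`. -/
noncomputable def expectedSwitches {V E : Type} [DecidableEq E] (G : PathInstance V E)
    (F B : Finset E) : ℝ≥0∞ :=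
  ∑' T : {T : CompTree E // CompTree.IsRun G F B T},
    CompTree.prob G F B T.1 * (T.1.numSwitches : ℝ≥0∞)

/-- The vertices of `G_{n,r,s,t}`. Indices start at `0`, so that `u i` stands for `u_{i+1}`,
and so on. -/
inductive CVertex (n r s : ℕ) : Type
  | target
  | u (i : Fin n)
  | w (i : Fin n)
  | a (i : Fin n) (j : Fin r) (k : Fin s)
  | b (i : Fin n) (j : Fin (r * s))

/-- The edges of `G_{n,r,s,t}`; the last argument `l : Fin t` numbers the copies of a
multi-edge. -/
inductive CEdge (n r s t : ℕ) : Type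
  | a1 (i : Fin n) (j : Fin r) (k : Fin s)
  | a0 (i : Fin n) (j : Fin r) (k : Fin s) (l : Fin t)
  | b1 (i : Fin n) (j : Fin (r * s))
  | b0 (i : Fin n) (j : Fin (r * s)) (l : Fin t)
  | u1 (i : Fin n) (l : Fin t)
  | u0 (i : Fin n) (l : Fin t)
  | wj (i : Fin n) (j : Fin r) (l : Fin t)
  | w0 (i : Fin n) (l : Fin t)
  deriving DecidableEq, Fintype

namespace CVertex

variable {n r s : ℕ}

/-- The vertex `u` of the next level; after the last level, it is the target. -/
def uNext (i : Fin n) : CVertex n r s :=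
  if h : i.val + 1 < n then u ⟨i.val + 1, h⟩ else target

/-- The vertex `w` of the next level; after the last level, it is the target. -/
def wNext (i : Fin n) : CVertex n r s :=
  if h : i.val + 1 < n then w ⟨i.val + 1, h⟩ else target

/-- The first vertex of the `b`-path of a level (for `r, s ≥ 1`; otherwise it does not exist and
the target serves as a placeholder). -/
def bFirst (i : Fin n) : CVertex n r s :=
  if h : 0 < r * s then b i ⟨0, h⟩ else target

/-- The first vertex of the `j`-th `a`-path of a level (for `s ≥ 1`; otherwise it does not exist
and the target serves as a placeholder). -/
def aFirst (i : Fin n) (j : Fin r) : CVertex n r s :=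
  if h : 0 < s then a i j ⟨0, h⟩ else target

end CVertex

namespace CEdge

variable {n r s t : ℕ}

/-- The zero-edges (superscript `0`); the remaining edges are the one-edges. -/
def IsZero : CEdge n r s t → Prop
  | a0 _ _ _ _ => True
  | b0 _ _ _ => True
  | u0 _ _ => True
  | w0 _ _ => True
  | _ => False

def src : CEdge n r s t → CVertex n r s
  | a1 i j k => .a i j k
  | a0 i j k _ => .a i j k
  | b1 i j => .b i j
  | b0 i j _ => .b i j
  | u1 i _ => .u i
  | u0 i _ => .u i
  | wj i _ _ => .w i
  | w0 i _ => .w i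

def dst : CEdge n r s t → CVertex n r s
  | a1 i j k => if h : k.val + 1 < s then .a i j ⟨k.val + 1, h⟩ else .bFirst i
  | a0 i _ _ _ => .uNext i
  | b1 i j => if h : j.val + 1 < r * s then .b i ⟨j.val + 1, h⟩ else .wNext i
  | b0 i _ _ => .uNext i
  | u1 i _ => .bFirst i
  | u0 i _ => .uNext i
  | wj i j _ => .aFirst i j
  | w0 i _ => .wNext i

/-- The costs, with `ε = 1 / (r s)`; the level that `i : Fin n` stands for is `i + 1`. -/
noncomputable def cost : CEdge n r s t → ℝ
  | a1 _ _ _ => 0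
  | a0 i _ k _ => 2 ^ (2 * (i.val + 1) + 1) + (k.val : ℝ) * (1 / ((r : ℝ) * s))
  | b1 _ _ => 0
  | b0 i j _ => 2 ^ (2 * (i.val + 1) + 1) + 1 + (j.val : ℝ) * (1 / ((r : ℝ) * s))
  | u1 _ _ => 0
  | u0 i _ => 2 ^ (2 * (i.val + 1))
  | wj _ _ _ => 0
  | w0 i _ => 2 ^ (2 * (i.val + 1))

end CEdge

/-- The shortest-path instance `G_{n,r,s,t}`. -/
noncomputable def counterGraph (n r s t : ℕ) :
    PathInstance (CVertex n r s) (CEdge n r s t) where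
  src := CEdge.src
  dst := CEdge.dst
  cost := CEdge.cost
  target := CVertex.target

/-- The number `M` of edges of `G_{n,r,s,t}`. -/
def numEdges (n r s t : ℕ) : ℕ := Fintype.card (CEdge n r s t)

/-! The graph is a binary counter. Suppose that `F` contains a copy of every multi-edge, and look at
a tree that is optimal for `F`. A level whose `b`-path is interrupted in `F` sends both `u` and `w`
to the next level at the same cost (bit 0). A level with a complete `b`-path and some complete
`a`-path lets both reach the next `w` for free (bit 1). So the costs of `u` and `w` agree level by
level from the top (`Sound.val_eq`, `val_uNext_eq`). If the `b`-path is complete but every `a`-path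
is interrupted, only `u` profits, and the gap between `u` and `w` drives every lower level off its
`b`-path (`reset_below`).

Random-Facet moves between two kinds of states. In `Counting`, the `b`-edges of the active levels
are in `F` but not in the tree. If such an edge of level `y` is picked, the first call goes on
counting without level `y`. It returns a tree in which the remaining active bits are set. The picked
edge then improves this tree, and the second call starts in `Setting`: the bits below `y` are set,
and the `a`-edges of `y` are still outside the tree. Picks there interrupt the `a`-paths of `y` one
after another. When the last one is hit, the first call returns a tree that has reset all lower
levels, and the second call counts afresh with the active levels below `y`. So a counted bit is
followed by two further counts, one in each call.

One plus the number of switches is additive over the two calls (`le_one_add_expectedSwitches`). The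
lower bounds `countingValue` and `settingValue` are therefore proved by induction along the calls
(`counting_step`, `setting_step`), without analysing random events separately. Each generation
counts two bits, taken from the `g` highest active levels, so that it uses up about `g` levels and
doubles the value. A discount is subtracted for possible failures: `copyWeight` for losing all
copies of a multi-edge, `pathWeight` for losing all `a`-paths of an active level, and `h / S` for
lost levels. One random pick increases the discount on average, and this is paid for by a factor `K`
saved per counted bit and a factor `η` saved per interrupted `a`-path.

To keep the total factor from `K` bounded over `k` generations, `g` has to be of order `k`. Then `g
* k ≤ n / 2` allows `k` of order `√n`. The sizes of `r` and `t` make the initial weights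
polynomially small, and that of `s` keeps the total factor from `η` below `n`. -/

/-! ### Path costs, switches and optimal trees in acyclic graphs. -/

namespace PathInstance

variable {V E : Type} {G : PathInstance V E} {B F : Finset E}

/-- A rank function that decreases along the edges; no edge leaves the target. -/
structure IsRanked (G : PathInstance V E) (rank : V → ℕ) : Prop where
  src_ne : ∀ e, G.src e ≠ G.target
  lt : ∀ e, rank (G.dst e) < rank (G.src e)

theorem PathCost.inv {v : V} {x : ℝ} (h : G.PathCost B v x) :
    (v = G.target ∧ x = 0) ∨
      ∃ e y, e ∈ B ∧ G.src e = v ∧ G.PathCost B (G.dst e) y ∧ x = G.cost e + y := by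
  cases h with
  | target => exact Or.inl ⟨rfl, rfl⟩
  | step e y he hy => exact Or.inr ⟨e, y, he, rfl, hy, rfl⟩

theorem IsTree.edge_unique (hB : G.IsTree B) {e e' : E} (he : e ∈ B) (he' : e' ∈ B)
    (h : G.src e = G.src e') : e = e' :=
  (hB.1 (G.src e') (hB.2.1 e' he')).unique ⟨he, h⟩ ⟨he', rfl⟩

theorem IsTree.pathCost_unique (hB : G.IsTree B) {v : V} {x : ℝ} (hx : G.PathCost B v x) :
    ∀ {y : ℝ}, G.PathCost B v y → x = y := by
  induction hx with
  | target =>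
    intro y hy
    rcases hy.inv with ⟨-, h⟩ | ⟨e, _, he, hs, -⟩
    · exact h.symm
    · exact absurd hs (hB.2.1 e he)
  | step e x he _ ih =>
    intro y hy
    rcases hy.inv with ⟨h, -⟩ | ⟨e', z, he', hs, hz, rfl⟩
    · exact absurd h (hB.2.1 e he)
    · obtain rfl := hB.edge_unique he' he hs
      rw [ih hz]

open Classical in
/-- The cost of the path from `v` to the target in the tree `B`. -/
noncomputable def dist (G : PathInstance V E) (B : Finset E) (v : V) : ℝ :=
  if h : ∃ x, G.PathCost B v x then h.choose else 0

theorem IsTree.pathCost_dist (hB : G.IsTree B) (v : V) : G.PathCost B v (G.dist B v) := by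
  have h := hB.2.2 v
  rw [dist, dif_pos h]
  exact h.choose_spec

theorem IsTree.dist_eq (hB : G.IsTree B) {v : V} {x : ℝ} (h : G.PathCost B v x) :
    G.dist B v = x :=
  hB.pathCost_unique (hB.pathCost_dist v) h

theorem IsTree.dist_target (hB : G.IsTree B) : G.dist B G.target = 0 :=
  hB.dist_eq PathCost.target

theorem IsTree.dist_src (hB : G.IsTree B) {e : E} (he : e ∈ B) :
    G.dist B (G.src e) = G.cost e + G.dist B (G.dst e) :=
  hB.dist_eq (PathCost.step e _ he (hB.pathCost_dist _))

theorem IsTree.improving_iff (hB : G.IsTree B) {e : E} :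
    G.Improving B e ↔ G.cost e + G.dist B (G.dst e) < G.dist B (G.src e) := by
  constructor
  · rintro ⟨x, y, hx, hy, h⟩
    rwa [hB.dist_eq hx, hB.dist_eq hy]
  · intro h
    exact ⟨_, _, hB.pathCost_dist _, hB.pathCost_dist _, h⟩

theorem mem_switch {e e' : E} :
    e' ∈ G.switch B e ↔ e' = e ∨ (e' ∈ B ∧ G.src e' ≠ G.src e) := by
  classical
  simp [switch]

theorem switch_subset {e : E} (hF : B ⊆ F) (he : e ∈ F) : G.switch B e ⊆ F := by
  intro e' h
  rcases mem_switch.1 h with rfl | h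
  · exact he
  · exact hF h.1

variable {rank : V → ℕ}

theorem IsRanked.exists_pathCost (hG : G.IsRanked rank)
    (h : ∀ v, v ≠ G.target → ∃ e ∈ B, G.src e = v) (v : V) : ∃ x, G.PathCost B v x := by
  induction hn : rank v using Nat.strong_induction_on generalizing v with
  | _ m ih =>
    by_cases hv : v = G.target
    · subst hv
      exact ⟨0, PathCost.target⟩
    · obtain ⟨e, he, rfl⟩ := h v hv
      obtain ⟨x, hx⟩ := ih _ (hn ▸ hG.lt e) (G.dst e) rfl
      exact ⟨_, PathCost.step e x he hx⟩

theorem IsRanked.isTree_switch (hG : G.IsRanked rank) (hB : G.IsTree B) (e : E) :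
    G.IsTree (G.switch B e) := by
  have hu : ∀ v, v ≠ G.target → ∃! e', e' ∈ G.switch B e ∧ G.src e' = v := by
    intro v hv
    by_cases hve : v = G.src e
    · refine ⟨e, ⟨mem_switch.2 (Or.inl rfl), hve.symm⟩, ?_⟩
      rintro e' ⟨h, hs⟩
      rcases mem_switch.1 h with rfl | h
      · rfl
      · exact absurd (hs.trans hve) h.2
    · obtain ⟨e₁, ⟨h₁, rfl⟩, h₂⟩ := hB.1 v hv
      refine ⟨e₁, ⟨mem_switch.2 (Or.inr ⟨h₁, hve⟩), rfl⟩, ?_⟩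
      rintro e' ⟨h, hs⟩
      rcases mem_switch.1 h with rfl | h
      · exact absurd hs.symm hve
      · exact h₂ e' ⟨h.1, hs⟩
  exact ⟨hu, fun e' _ => hG.src_ne e',
    hG.exists_pathCost fun v hv => (hu v hv).exists⟩

/-- Induct on the rank: the new edge is cheaper than the old path of its tail by assumption, and
every other edge of the new tree already belongs to the old one. -/
theorem IsRanked.dist_switch_le (hG : G.IsRanked rank) (hB : G.IsTree B) {e : E}
    (he : G.Improving B e) (v : V) : G.dist (G.switch B e) v ≤ G.dist B v := by
  have hS := hG.isTree_switch hB e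
  induction hn : rank v using Nat.strong_induction_on generalizing v with
  | _ m ih =>
    by_cases hv : v = G.target
    · subst hv
      rw [hS.dist_target, hB.dist_target]
    · obtain ⟨e', he', rfl⟩ := (hS.1 v hv).exists
      have h1 := ih _ (hn ▸ hG.lt e') (G.dst e') rfl
      rw [hS.dist_src he']
      rcases mem_switch.1 he' with rfl | h
      · have := hB.improving_iff.1 he
        linarith
      · rw [hB.dist_src h.1]
        linarith

theorem IsRanked.dist_switch_lt (hG : G.IsRanked rank) (hB : G.IsTree B) {e : E}
    (he : G.Improving B e) : G.dist (G.switch B e) (G.src e) < G.dist B (G.src e) := by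
  have hS := hG.isTree_switch hB e
  have h1 := hG.dist_switch_le hB he (G.dst e)
  have h2 := hB.improving_iff.1 he
  rw [hS.dist_src (mem_switch.2 (Or.inl rfl))]
  linarith

/-- The tree `B` is optimal among the trees whose edges belong to `F`. -/
structure IsOptimal (G : PathInstance V E) (F B : Finset E) : Prop where
  isTree : G.IsTree B
  subset : B ⊆ F
  not_improving : ∀ e ∈ F, ¬ G.Improving B e

theorem IsOptimal.dist_le (h : G.IsOptimal F B) {e : E} (he : e ∈ F) :
    G.dist B (G.src e) ≤ G.cost e + G.dist B (G.dst e) := by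
  have := h.not_improving e he
  rwa [h.isTree.improving_iff, not_lt] at this

/-- All path costs in `B'` are at most those in `B`, and one of them is smaller. -/
def Better (G : PathInstance V E) (B' B : Finset E) : Prop :=
  (∀ v, G.dist B' v ≤ G.dist B v) ∧ ∃ v, G.dist B' v < G.dist B v

theorem better_wellFounded [Finite E] : WellFounded G.Better := by
  have : IsTrans (Finset E) G.Better :=
    ⟨fun _ _ _ h h' => ⟨fun v => (h.1 v).trans (h'.1 v),
      h.2.imp fun v hv => hv.trans_le (h'.1 v)⟩⟩
  have : Std.Irrefl G.Better := ⟨fun _ h => h.2.elim fun _ => lt_irrefl _⟩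
  exact Finite.wellFounded_of_trans_of_irrefl _

/-- Induction along the recursive calls of Random-Facet. -/
theorem tree_induction [Finite E] [DecidableEq E] {P : Finset E → Finset E → Prop}
    (step : ∀ F B, G.IsTree B → B ⊆ F → (∀ e ∈ F \ B, P (F.erase e) B) →
      (∀ B', G.IsTree B' → B' ⊆ F → G.Better B' B → P F B') → P F B)
    {F B : Finset E} (hB : G.IsTree B) (hF : B ⊆ F) : P F B := by
  -- The order is lexicographic. The first call loses an edge of `F`; the second keeps `F` but
  -- starts from a better tree.
  induction hn : F.card using Nat.strong_induction_on generalizing F B with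
  | _ m ih =>
    induction B using (better_wellFounded (G := G)).induction with
    | _ B ihB =>
      refine step F B hB hF (fun e he => ?_) fun B' hB' hF' h => ihB B' h hB' hF'
      rw [Finset.mem_sdiff] at he
      exact ih _ (hn ▸ Finset.card_erase_lt_of_mem he.1) hB
        (Finset.subset_erase.2 ⟨hF, he.2⟩) rfl

end PathInstance

/-! ### Finite runs of Random-Facet and what they return. -/

namespace CompTree

variable {V E : Type} {G : PathInstance V E} {rank : V → ℕ} [DecidableEq E]

/-- A node without a right child certifies that the picked edge does not improve the tree returned
by its left child, and a right child is itself a run on all of `F`. The monotonicity of the costs is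
carried along because it supplies the descent needed for `tree_induction`. -/
theorem IsRun.isOptimal_result (hG : G.IsRanked rank) {T : CompTree E} :
    ∀ {F B : Finset E}, G.IsTree B → B ⊆ F → IsRun G F B T →
      G.IsOptimal F (result G B T) ∧ ∀ v, G.dist (result G B T) v ≤ G.dist B v := by
  have erase_sub : ∀ {F B : Finset E} {e : E}, B ⊆ F → e ∈ F \ B → B ⊆ F.erase e :=
    fun hF he => Finset.subset_erase.2 ⟨hF, (Finset.mem_sdiff.1 he).2⟩
  induction T with
  | leaf =>
    intro F B hB hF h
    have h : F = B := h
    subst h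
    refine ⟨⟨hB, hF, fun e he => ?_⟩, fun v => le_rfl⟩
    change ¬ G.Improving F e
    rw [hB.improving_iff, hB.dist_src he]
    exact lt_irrefl _
  | left e l ihl =>
    rintro F B hB hF ⟨he, hl, hi⟩
    obtain ⟨hopt, hd⟩ := ihl hB (erase_sub hF he) hl
    refine ⟨⟨hopt.isTree, hopt.subset.trans (Finset.erase_subset _ _), fun e' he' => ?_⟩, hd⟩
    by_cases hee : e' = e
    · rw [hee]
      exact hi
    · exact hopt.not_improving e' (Finset.mem_erase.2 ⟨hee, he'⟩)
  | both e l r ihl ihr =>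
    rintro F B hB hF ⟨he, hl, hi, hr⟩
    obtain ⟨hopt, hd⟩ := ihl hB (erase_sub hF he) hl
    obtain ⟨hopt', hd'⟩ := ihr (hG.isTree_switch hopt.isTree e)
      (PathInstance.switch_subset (hopt.subset.trans (Finset.erase_subset _ _))
        (Finset.mem_sdiff.1 he).1) hr
    exact ⟨hopt', fun v => (hd' v).trans ((hG.dist_switch_le hopt.isTree hi v).trans (hd v))⟩

/-- The call structure of a computation tree. -/
def equivSum (E : Type) :
    CompTree E ≃ Unit ⊕ (E × CompTree E) ⊕ (E × CompTree E × CompTree E) where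
  toFun
    | leaf => Sum.inl ()
    | left e l => Sum.inr (Sum.inl (e, l))
    | both e l r => Sum.inr (Sum.inr (e, l, r))
  invFun
    | Sum.inl _ => leaf
    | Sum.inr (Sum.inl (e, l)) => left e l
    | Sum.inr (Sum.inr (e, l, r)) => both e l r
  left_inv T := by cases T <;> rfl
  right_inv x := by rcases x with _ | _ | _ <;> rfl

theorem tsum_eq {E : Type} [Fintype E] (f : CompTree E → ℝ≥0∞) :
    ∑' T, f T = f leaf + (∑ e, ∑' l, f (left e l) + ∑ e, ∑' l, ∑' r, f (both e l r)) := by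
  rw [← (equivSum E).symm.tsum_eq f, ENNReal.summable.tsum_sum ENNReal.summable,
    ENNReal.summable.tsum_sum ENNReal.summable]
  congr 1
  · exact tsum_fintype _ |>.trans (by simp [equivSum])
  · congr 1
    · rw [ENNReal.tsum_prod', tsum_fintype]
      rfl
    · rw [ENNReal.tsum_prod', tsum_fintype]
      refine Finset.sum_congr rfl fun e _ => ?_
      rw [ENNReal.tsum_prod']
      rfl

end CompTree

/-! ### Probabilities of runs and the recurrence for the expected number of switches. -/

namespace CompTree

variable {V E : Type} {G : PathInstance V E} {rank : V → ℕ} [DecidableEq E]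

open Classical in
/-- The probability of a computation tree, extended by `0` to the trees that the call cannot
generate. -/
noncomputable def weight (G : PathInstance V E) (F B : Finset E) (T : CompTree E) : ℝ≥0∞ :=
  if IsRun G F B T then prob G F B T else 0

/-- The probability that `Random-Facet(F, B)` terminates. -/
noncomputable def mass (G : PathInstance V E) (F B : Finset E) : ℝ≥0∞ :=
  ∑' T, weight G F B T

/-- Summing over all computation trees, with weight `0` where no run exists, allows the sum to be
split by constructors. -/
theorem expectedSwitches_eq (F B : Finset E) :
    expectedSwitches G F B = ∑' T, weight G F B T * (T.numSwitches : ℝ≥0∞) := by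
  classical
  rw [expectedSwitches]
  change ∑' T : {T : CompTree E | IsRun G F B T},
    (fun T => prob G F B T * (T.numSwitches : ℝ≥0∞)) T = _
  rw [tsum_subtype {T : CompTree E | IsRun G F B T}
    (fun T => prob G F B T * (T.numSwitches : ℝ≥0∞))]
  refine tsum_congr fun T => ?_
  by_cases h : IsRun G F B T
  · rw [Set.indicator_of_mem (by exact h), weight, if_pos h]
  · rw [Set.indicator_of_notMem (by exact h), weight, if_neg h, zero_mul]

theorem weight_leaf {F B : Finset E} (h : F ≠ B) : weight G F B leaf = 0 :=
  if_neg h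

open Classical in
theorem weight_left {F B : Finset E} (e : E) (l : CompTree E) :
    weight G F B (left e l) = if e ∈ F \ B then ((F \ B).card : ℝ≥0∞)⁻¹ *
      (weight G (F.erase e) B l * if G.Improving (result G B l) e then 0 else 1) else 0 := by
  by_cases h1 : e ∈ F \ B <;> by_cases h2 : IsRun G (F.erase e) B l <;>
    by_cases h3 : G.Improving (result G B l) e <;> simp [weight, IsRun, prob, *]

open Classical in
theorem weight_both {F B : Finset E} (e : E) (l r : CompTree E) :
    weight G F B (both e l r) = if e ∈ F \ B then ((F \ B).card : ℝ≥0∞)⁻¹ *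
      (weight G (F.erase e) B l * if G.Improving (result G B l) e then
        weight G F (G.switch (result G B l) e) r else 0) else 0 := by
  by_cases h1 : e ∈ F \ B <;> by_cases h2 : IsRun G (F.erase e) B l <;>
    by_cases h3 : G.Improving (result G B l) e <;>
    by_cases h4 : IsRun G F (G.switch (result G B l) e) r <;>
    simp [weight, IsRun, prob, *, mul_assoc]

open Classical in
theorem tsum_weight_mul [Fintype E] {F B : Finset E} (h : F ≠ B) (f : CompTree E → ℝ≥0∞) :
    ∑' T, weight G F B T * f T = ((F \ B).card : ℝ≥0∞)⁻¹ * ∑ e ∈ F \ B, ∑' l,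
      weight G (F.erase e) B l * if G.Improving (result G B l) e then
        ∑' r, weight G F (G.switch (result G B l) e) r * f (both e l r) else f (left e l) := by
  rw [tsum_eq, weight_leaf h, zero_mul, zero_add, ← Finset.sum_add_distrib, Finset.mul_sum,
    ← Finset.sum_subset (Finset.subset_univ (F \ B))]
  · refine Finset.sum_congr rfl fun e he => ?_
    rw [← ENNReal.tsum_add, ← ENNReal.tsum_mul_left]
    refine tsum_congr fun l => ?_
    simp only [weight_left, weight_both, if_pos he]
    by_cases h3 : G.Improving (result G B l) e
    · simp only [if_pos h3, mul_zero, zero_mul, zero_add, mul_assoc, ENNReal.tsum_mul_left]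
    · simp [if_neg h3, mul_assoc]
  · intro e _ he
    simp only [weight_left, weight_both, if_neg he]
    simp

/-- Computation trees are finite, so this is almost sure termination. It holds because every call
leads to a smaller edge set or to a better tree. It is needed to factor expectations of sums over
the two successive calls. -/
theorem mass_eq_one [Fintype E] (hG : G.IsRanked rank) {F B : Finset E} (hB : G.IsTree B)
    (hF : B ⊆ F) : mass G F B = 1 := by
  classical
  refine PathInstance.tree_induction (P := fun F B => mass G F B = 1) ?_ hB hF
  intro F B hB hF ihl ihr
  by_cases h : F = B
  · subst h
    rw [mass, tsum_eq]
    simp [weight_left, weight_both]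
    simp [weight, IsRun, prob]
  · have hstep := tsum_weight_mul (G := G) h fun _ => 1
    simp only [mul_one] at hstep
    have hc : (F \ B).card ≠ 0 := fun h0 =>
      h (Finset.Subset.antisymm (Finset.sdiff_eq_empty_iff_subset.1 (Finset.card_eq_zero.1 h0)) hF)
    have hsum : ∀ e ∈ F \ B, (∑' l, weight G (F.erase e) B l *
        if G.Improving (result G B l) e then
          ∑' r, weight G F (G.switch (result G B l) e) r else 1) = 1 := by
      intro e he
      have he' := Finset.mem_sdiff.1 he
      refine Eq.trans ?_ (ihl e he)
      rw [mass]
      refine tsum_congr fun l => ?_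
      by_cases hl : IsRun G (F.erase e) B l
      · split_ifs with hi
        · obtain ⟨hopt, hd⟩ := hl.isOptimal_result hG hB
            (Finset.subset_erase.2 ⟨hF, he'.2⟩)
          have := ihr (G.switch (result G B l) e) (hG.isTree_switch hopt.isTree e)
            (PathInstance.switch_subset (hopt.subset.trans (Finset.erase_subset _ _)) he'.1)
            ⟨fun v => (hG.dist_switch_le hopt.isTree hi v).trans (hd v), G.src e,
              (hG.dist_switch_lt hopt.isTree hi).trans_le (hd _)⟩
          rw [mass] at this
          rw [this, mul_one]
        · rw [mul_one]
      · simp [weight, hl]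
    rw [mass, hstep, Finset.sum_congr rfl hsum]
    simp only [Finset.sum_const, nsmul_eq_mul, mul_one]
    exact ENNReal.inv_mul_cancel (by exact_mod_cast hc) (ENNReal.natCast_ne_top _)

/-- One step of Random-Facet: a call is followed by the call without the picked edge `e`, and,
where `e` improves every optimal tree of `F \ {e}`, by a call with `e`. -/
theorem le_one_add_expectedSwitches [Fintype E] (hG : G.IsRanked rank) {F B : Finset E}
    (hB : G.IsTree B) (hF : B ⊆ F) (h : F ≠ B) {a b : E → ℝ≥0∞}
    (ha : ∀ e ∈ F \ B, a e ≤ 1 + expectedSwitches G (F.erase e) B)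
    (hb : ∀ e ∈ F \ B, b e = 0 ∨ ∀ B', G.IsOptimal (F.erase e) B' →
      (∀ v, G.dist B' v ≤ G.dist B v) →
      G.Improving B' e ∧ b e ≤ 1 + expectedSwitches G F (G.switch B' e)) :
    ((F \ B).card : ℝ≥0∞)⁻¹ * ∑ e ∈ F \ B, (a e + b e) ≤ 1 + expectedSwitches G F B := by
  classical
  have h1 : 1 + expectedSwitches G F B =
      ∑' T, weight G F B T * (1 + (T.numSwitches : ℝ≥0∞)) := by
    simp only [mul_add, mul_one]
    rw [ENNReal.tsum_add, ← expectedSwitches_eq, ← mass, mass_eq_one hG hB hF]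
  rw [h1, tsum_weight_mul h]
  gcongr with e he
  have he' := Finset.mem_sdiff.1 he
  have hFe : B ⊆ F.erase e := Finset.subset_erase.2 ⟨hF, he'.2⟩
  -- Total mass one allows the constant `b e` to be moved under the sum over the outcomes of the
  -- first call.
  have h2 : 1 + expectedSwitches G (F.erase e) B + b e =
      ∑' l, weight G (F.erase e) B l * (1 + (l.numSwitches : ℝ≥0∞) + b e) := by
    simp only [mul_add, mul_one]
    rw [ENNReal.tsum_add, ENNReal.tsum_add, ← expectedSwitches_eq, ENNReal.tsum_mul_right,
      ← mass, mass_eq_one hG hB hFe, one_mul]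
  refine (add_le_add_left (ha e he) _).trans ?_
  rw [h2]
  refine ENNReal.tsum_le_tsum fun l => ?_
  by_cases hl : IsRun G (F.erase e) B l
  swap
  · simp [weight, hl]
  obtain ⟨hopt, hd⟩ := hl.isOptimal_result hG hB hFe
  gcongr
  split_ifs with hi
  · have hS := hG.isTree_switch hopt.isTree e
    have hSF := PathInstance.switch_subset (G := G) (hopt.subset.trans (Finset.erase_subset _ _))
      he'.1
    -- The switch between the two calls supplies the second `1`: one plus the switches of the whole
    -- run is the sum of the same quantity over both calls.
    have h3 : ∑' r, weight G F (G.switch (result G B l) e) r *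
        (1 + ((both e l r).numSwitches : ℝ≥0∞)) = 1 + (l.numSwitches : ℝ≥0∞) +
          (1 + expectedSwitches G F (G.switch (result G B l) e)) := by
      have : ∀ r, weight G F (G.switch (result G B l) e) r *
        (1 + ((both e l r).numSwitches : ℝ≥0∞)) =
          weight G F (G.switch (result G B l) e) r * (2 + (l.numSwitches : ℝ≥0∞)) +
          weight G F (G.switch (result G B l) e) r * (r.numSwitches : ℝ≥0∞) := by
        intro r
        rw [numSwitches]
        push_cast
        ring
      rw [tsum_congr this, ENNReal.tsum_add, ENNReal.tsum_mul_right, ← mass,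
        mass_eq_one hG hS hSF, ← expectedSwitches_eq]
      ring
    rw [h3]
    gcongr
    -- With `b e = 0` the second call is simply ignored, whether or not it takes place.
    rcases hb e he with h0 | hb
    · rw [h0]
      exact zero_le
    · exact (hb _ hopt hd).2
  · rcases hb e he with h0 | hb
    · rw [h0, add_zero, numSwitches]
    · exact absurd (hb _ hopt hd).1 hi

/-- A real lower bound for the expected number of improving switches follows from lower bounds
for the subsequent calls. -/
theorem ofReal_le_one_add_expectedSwitches [Fintype E] (hG : G.IsRanked rank) {F B : Finset E}
    (hB : G.IsTree B) (hF : B ⊆ F) (h : F ≠ B) {x : ℝ} {φ : E → ℝ}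
    (hφ : ((F \ B).card : ℝ) * x ≤ ∑ e ∈ F \ B, φ e)
    (H : ∀ e ∈ F \ B, ∃ a b : ℝ, φ e ≤ a + b ∧
      ENNReal.ofReal a ≤ 1 + expectedSwitches G (F.erase e) B ∧
      (b ≤ 0 ∨ ∀ B', G.IsOptimal (F.erase e) B' → G.Improving B' e ∧
        (G.Better (G.switch B' e) B →
          ENNReal.ofReal b ≤ 1 + expectedSwitches G F (G.switch B' e)))) :
    ENNReal.ofReal x ≤ 1 + expectedSwitches G F B := by
  classical
  have hc : 0 < (F \ B).card := Nat.pos_of_ne_zero fun h0 =>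
    h (Finset.Subset.antisymm (Finset.sdiff_eq_empty_iff_subset.1 (Finset.card_eq_zero.1 h0)) hF)
  have hc' : (0 : ℝ) < (F \ B).card := by exact_mod_cast hc
  choose! a b hab ha hb using H
  refine le_trans ?_ (le_one_add_expectedSwitches hG hB hF h (a := fun e => ENNReal.ofReal (a e))
    (b := fun e => ENNReal.ofReal (b e)) ha fun e he => ?_)
  · have h1 : x ≤ ((F \ B).card : ℝ)⁻¹ * ∑ e ∈ F \ B, φ e := by
      rw [inv_mul_eq_div, le_div_iff₀ hc']
      linarith
    refine (ENNReal.ofReal_le_ofReal h1).trans ?_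
    rw [ENNReal.ofReal_mul (by positivity), ENNReal.ofReal_inv_of_pos hc',
      ENNReal.ofReal_natCast]
    gcongr
    refine (Finset.le_sum_of_subadditive ENNReal.ofReal ENNReal.ofReal_zero.le
      (fun _ _ => ENNReal.ofReal_add_le) _ _).trans ?_
    gcongr with e he
    exact (ENNReal.ofReal_le_ofReal (hab e he)).trans ENNReal.ofReal_add_le
  · rcases hb e he with h0 | h0
    · exact Or.inl (ENNReal.ofReal_of_nonpos h0)
    · refine Or.inr fun B' hB' hd => ?_
      obtain ⟨hi, h1⟩ := h0 B' hB'
      exact ⟨hi, h1 ⟨fun v => (hG.dist_switch_le hB'.isTree hi v).trans (hd v), G.src e,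
        (hG.dist_switch_lt hB'.isTree hi).trans_le (hd _)⟩⟩

end CompTree

/-! ### Optimal trees along a single `b`-path or `a`-path. -/

namespace CounterGraph

variable {n r s t : ℕ}

/-- The number of edges on a longest path to the target, up to a slack at each level. -/
def rank : CVertex n r s → ℕ
  | .target => 0
  | .u i => (n - i) * (r * s + s + 2)
  | .w i => (n - i) * (r * s + s + 2)
  | .a i _ k => (n - 1 - i) * (r * s + s + 2) + r * s + (s - k) + 1
  | .b i j => (n - 1 - i) * (r * s + s + 2) + (r * s - j)

theorem rank_uNext (i : Fin n) :
    rank (CVertex.uNext i : CVertex n r s) = (n - 1 - i) * (r * s + s + 2) := by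
  have := i.2
  unfold CVertex.uNext
  split_ifs with h
  · simp only [rank]
    congr 1
    omega
  · have : n - 1 - i.val = 0 := by omega
    simp [rank, this]

theorem rank_wNext (i : Fin n) :
    rank (CVertex.wNext i : CVertex n r s) = (n - 1 - i) * (r * s + s + 2) := by
  have := i.2
  unfold CVertex.wNext
  split_ifs with h
  · simp only [rank]
    congr 1
    omega
  · have : n - 1 - i.val = 0 := by omega
    simp [rank, this]

theorem rank_bFirst_le (i : Fin n) :
    rank (CVertex.bFirst i : CVertex n r s) ≤ (n - 1 - i) * (r * s + s + 2) + r * s := by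
  unfold CVertex.bFirst
  split_ifs with h <;> simp [rank]

theorem rank_aFirst_le (i : Fin n) (j : Fin r) :
    rank (CVertex.aFirst i j : CVertex n r s) ≤
      (n - 1 - i) * (r * s + s + 2) + r * s + s + 1 := by
  unfold CVertex.aFirst
  split_ifs with h <;> simp [rank]

theorem isRanked : (counterGraph n r s t).IsRanked rank := by
  have key : ∀ i : Fin n, (n - i.val) * (r * s + s + 2) =
      (n - 1 - i) * (r * s + s + 2) + (r * s + s + 2) := by
    intro i
    have h := i.2
    have : n - i.val = n - 1 - i.val + 1 := by omega
    rw [this, Nat.add_mul, one_mul]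
  refine ⟨fun e => ?_, fun e => ?_⟩
  · cases e <;> simp [counterGraph, CEdge.src]
  change rank e.dst < rank e.src
  cases e with
  | a1 i j k =>
    have := k.2
    change _ < (n - 1 - i.val) * (r * s + s + 2) + r * s + (s - k) + 1
    simp only [CEdge.dst]
    split_ifs with h
    · simp only [rank]
      omega
    · have := rank_bFirst_le (r := r) (s := s) i
      omega
  | a0 i j k l =>
    change rank (CVertex.uNext i) < (n - 1 - i.val) * (r * s + s + 2) + r * s + (s - k) + 1
    rw [rank_uNext]
    omega
  | b1 i j =>
    have := j.2
    change _ < (n - 1 - i.val) * (r * s + s + 2) + (r * s - j)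
    simp only [CEdge.dst]
    split_ifs with h
    · simp only [rank]
      omega
    · rw [rank_wNext]
      omega
  | b0 i j l =>
    have := j.2
    change rank (CVertex.uNext i) < (n - 1 - i.val) * (r * s + s + 2) + (r * s - j)
    rw [rank_uNext]
    omega
  | u1 i l =>
    have := rank_bFirst_le (r := r) (s := s) i
    change rank (CVertex.bFirst i) < (n - i.val) * (r * s + s + 2)
    rw [key]
    omega
  | u0 i l =>
    change rank (CVertex.uNext i) < (n - i.val) * (r * s + s + 2)
    rw [rank_uNext, key]
    omega
  | wj i j l =>
    have := rank_aFirst_le (r := r) (s := s) i j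
    change rank (CVertex.aFirst i j) < (n - i.val) * (r * s + s + 2)
    rw [key]
    omega
  | w0 i l =>
    change rank (CVertex.wNext i) < (n - i.val) * (r * s + s + 2)
    rw [rank_wNext, key]
    omega

/-- The edges of the `b`-path of level `i` belong to `S`. -/
def BPath (S : Finset (CEdge n r s t)) (i : Fin n) : Prop :=
  ∀ j, CEdge.b1 i j ∈ S

/-- The edges of the `j`-th `a`-path of level `i` belong to `S`. -/
def APath (S : Finset (CEdge n r s t)) (i : Fin n) (j : Fin r) : Prop :=
  ∀ k, CEdge.a1 i j k ∈ S

/-- Some copy of every multi-edge belongs to `F`. -/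
structure HasCopies (F : Finset (CEdge n r s t)) : Prop where
  a0 : ∀ i j k, ∃ l, CEdge.a0 i j k l ∈ F
  b0 : ∀ i j, ∃ l, CEdge.b0 i j l ∈ F
  u1 : ∀ i, ∃ l, CEdge.u1 i l ∈ F
  u0 : ∀ i, ∃ l, CEdge.u0 i l ∈ F
  wj : ∀ i j, ∃ l, CEdge.wj i j l ∈ F
  w0 : ∀ i, ∃ l, CEdge.w0 i l ∈ F

/-- The path costs of a tree of the graph. -/
noncomputable abbrev val (B : Finset (CEdge n r s t)) (v : CVertex n r s) : ℝ :=
  (counterGraph n r s t).dist B v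

variable {F B : Finset (CEdge n r s t)}

theorem exists_edge (h : (counterGraph n r s t).IsOptimal F B) (v : CVertex n r s)
    (hv : v ≠ .target) : ∃ e ∈ B, e.src = v ∧ val B v = e.cost + val B e.dst := by
  obtain ⟨e, ⟨he, rfl⟩, -⟩ := h.isTree.1 v hv
  exact ⟨e, he, rfl, h.isTree.dist_src he⟩

theorem val_src_eq (h : (counterGraph n r s t).IsOptimal F B) {e : CEdge n r s t} (he : e ∈ B) :
    val B e.src = e.cost + val B e.dst :=
  h.isTree.dist_src he

theorem val_src_le (h : (counterGraph n r s t).IsOptimal F B) {e : CEdge n r s t} (he : e ∈ F) :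
    val B e.src ≤ e.cost + val B e.dst :=
  h.dist_le he

theorem val_b_cases (h : (counterGraph n r s t).IsOptimal F B) (i : Fin n) (j : Fin (r * s)) :
    (CEdge.b1 i j ∈ B ∧ val B (.b i j) = val B (CEdge.b1 i j : CEdge n r s t).dst) ∨
    (CEdge.b1 i j ∉ B ∧ val B (.b i j) = 2 * 2 ^ (2 * (i.val + 1)) + 1 +
      (j.val : ℝ) * (1 / ((r : ℝ) * s)) + val B (.uNext i)) := by
  by_cases hb : CEdge.b1 i j ∈ B
  · refine Or.inl ⟨hb, ?_⟩
    have := val_src_eq h hb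
    simpa only [CEdge.src, CEdge.cost, zero_add] using this
  · refine Or.inr ⟨hb, ?_⟩
    obtain ⟨e, he, hs, hv⟩ := exists_edge h (.b i j) (by simp)
    cases e <;> simp only [CEdge.src, CVertex.b.injEq, reduceCtorEq] at hs
    · obtain ⟨rfl, rfl⟩ := hs
      exact absurd he hb
    · obtain ⟨rfl, rfl⟩ := hs
      rw [hv]
      simp only [CEdge.cost, CEdge.dst]
      ring

theorem val_a_cases (h : (counterGraph n r s t).IsOptimal F B) (i : Fin n) (j : Fin r)
    (k : Fin s) :
    (CEdge.a1 i j k ∈ B ∧ val B (.a i j k) = val B (CEdge.a1 i j k : CEdge n r s t).dst) ∨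
    (CEdge.a1 i j k ∉ B ∧ val B (.a i j k) = 2 * 2 ^ (2 * (i.val + 1)) +
      (k.val : ℝ) * (1 / ((r : ℝ) * s)) + val B (.uNext i)) := by
  by_cases hb : CEdge.a1 i j k ∈ B
  · refine Or.inl ⟨hb, ?_⟩
    have := val_src_eq h hb
    simpa only [CEdge.src, CEdge.cost, zero_add] using this
  · refine Or.inr ⟨hb, ?_⟩
    obtain ⟨e, he, hs, hv⟩ := exists_edge h (.a i j k) (by simp)
    cases e <;> simp only [CEdge.src, CVertex.a.injEq, reduceCtorEq] at hs
    · obtain ⟨rfl, rfl, rfl⟩ := hs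
      exact absurd he hb
    · obtain ⟨rfl, rfl, rfl⟩ := hs
      rw [hv]
      simp only [CEdge.cost, CEdge.dst]
      ring

theorem val_u_cases (h : (counterGraph n r s t).IsOptimal F B) (i : Fin n) :
    val B (.u i) = val B (.bFirst i) ∨
      val B (.u i) = 2 ^ (2 * (i.val + 1)) + val B (.uNext i) := by
  obtain ⟨e, he, hs, hv⟩ := exists_edge h (.u i) (by simp)
  cases e <;> simp only [CEdge.src, CVertex.u.injEq, reduceCtorEq] at hs <;> subst hs
  · exact Or.inl (by simpa [CEdge.cost, CEdge.dst] using hv)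
  · exact Or.inr hv

theorem val_w_cases (h : (counterGraph n r s t).IsOptimal F B) (i : Fin n) :
    (∃ j, val B (.w i) = val B (.aFirst i j)) ∨
      val B (.w i) = 2 ^ (2 * (i.val + 1)) + val B (.wNext i) := by
  obtain ⟨e, he, hs, hv⟩ := exists_edge h (.w i) (by simp)
  cases e with
  | wj i' j l =>
    simp only [CEdge.src, CVertex.w.injEq] at hs
    subst hs
    exact Or.inl ⟨j, by simpa [CEdge.cost, CEdge.dst] using hv⟩
  | w0 i' l =>
    simp only [CEdge.src, CVertex.w.injEq] at hs
    subst hs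
    exact Or.inr hv
  | _ => simp [CEdge.src] at hs

theorem val_u_le (h : (counterGraph n r s t).IsOptimal F B) (hc : HasCopies F) (i : Fin n) :
    val B (.u i) ≤ val B (.bFirst i) ∧
      val B (.u i) ≤ 2 ^ (2 * (i.val + 1)) + val B (.uNext i) := by
  obtain ⟨l, hl⟩ := hc.u1 i
  obtain ⟨l', hl'⟩ := hc.u0 i
  have h1 := val_src_le h hl
  have h2 := val_src_le h hl'
  simp only [CEdge.src, CEdge.dst, CEdge.cost, zero_add] at h1 h2
  exact ⟨h1, h2⟩

theorem val_w_le (h : (counterGraph n r s t).IsOptimal F B) (hc : HasCopies F) (i : Fin n) :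
    (∀ j, val B (.w i) ≤ val B (.aFirst i j)) ∧
      val B (.w i) ≤ 2 ^ (2 * (i.val + 1)) + val B (.wNext i) := by
  obtain ⟨l', hl'⟩ := hc.w0 i
  have h2 := val_src_le h hl'
  simp only [CEdge.src, CEdge.dst, CEdge.cost] at h2
  refine ⟨fun j => ?_, h2⟩
  obtain ⟨l, hl⟩ := hc.wj i j
  have h1 := val_src_le h hl
  simpa only [CEdge.src, CEdge.dst, CEdge.cost, zero_add] using h1

theorem val_b_le (h : (counterGraph n r s t).IsOptimal F B) (hc : HasCopies F) (i : Fin n)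
    (j : Fin (r * s)) : val B (.b i j) ≤ 2 * 2 ^ (2 * (i.val + 1)) + 1 +
      (j.val : ℝ) * (1 / ((r : ℝ) * s)) + val B (.uNext i) := by
  obtain ⟨l, hl⟩ := hc.b0 i j
  have h1 := val_src_le h hl
  simp only [CEdge.src, CEdge.dst, CEdge.cost] at h1
  rw [pow_succ] at h1
  linarith

theorem val_a_le (h : (counterGraph n r s t).IsOptimal F B) (hc : HasCopies F) (i : Fin n)
    (j : Fin r) (k : Fin s) : val B (.a i j k) ≤ 2 * 2 ^ (2 * (i.val + 1)) +
      (k.val : ℝ) * (1 / ((r : ℝ) * s)) + val B (.uNext i) := by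
  obtain ⟨l, hl⟩ := hc.a0 i j k
  have h1 := val_src_le h hl
  simp only [CEdge.src, CEdge.dst, CEdge.cost] at h1
  rw [pow_succ] at h1
  linarith

theorem mul_eps_lt_one {j : ℕ} (h : j < r * s) : (j : ℝ) * (1 / ((r : ℝ) * s)) < 1 := by
  have h0 : (0 : ℝ) < (r : ℝ) * s := by exact_mod_cast (Nat.zero_le j).trans_lt h
  rw [mul_one_div, div_lt_one h0]
  exact_mod_cast h

theorem mul_eps_nonneg (j : ℕ) : (0 : ℝ) ≤ (j : ℝ) * (1 / ((r : ℝ) * s)) := by positivity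

theorem mul_eps_lt_succ {j : ℕ} (h : j < r * s) :
    (j : ℝ) * (1 / ((r : ℝ) * s)) < ((j + 1 : ℕ) : ℝ) * (1 / ((r : ℝ) * s)) := by
  have h0 : (0 : ℝ) < (r : ℝ) * s := by exact_mod_cast (Nat.zero_le j).trans_lt h
  have : 0 < 1 / ((r : ℝ) * s) := by positivity
  push_cast
  linarith

/-- The end of a `b`-path that is contained in `F` is used by an optimal tree if the next vertex
`w` is not too expensive. -/
theorem b_ones (h : (counterGraph n r s t).IsOptimal F B) (i : Fin n)
    (hY : val B (.wNext i) < val B (.uNext i) + 2 * 2 ^ (2 * (i.val + 1)) + 1)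
    (j : Fin (r * s)) (hF : ∀ j', j ≤ j' → CEdge.b1 i j' ∈ F) :
    val B (.b i j) = val B (.wNext i) ∧ CEdge.b1 i j ∈ B := by
  induction hm : r * s - j.val using Nat.strong_induction_on generalizing j with
  | _ m ih =>
    have hj := j.2
    have hd : val B (CEdge.b1 i j : CEdge n r s t).dst = val B (.wNext i) := by
      simp only [CEdge.dst]
      split_ifs with h1
      · exact (ih (r * s - (j.val + 1)) (by omega) ⟨j.val + 1, h1⟩
          (fun j' hj' => hF j' (le_trans (Fin.mk_le_mk.2 (Nat.le_succ _)) hj')) rfl).1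
      · rfl
    have hle := val_src_le h (hF j le_rfl)
    rw [hd] at hle
    simp only [CEdge.src, CEdge.cost, zero_add] at hle
    rcases val_b_cases h i j with ⟨h1, h2⟩ | ⟨h1, h2⟩
    · exact ⟨h2.trans hd, h1⟩
    · have := mul_eps_nonneg (r := r) (s := s) j.val
      linarith

/-- The zero-edges become dearer by `ε` from each vertex to the next, so it never pays to follow a
one-edge and leave by a later zero-edge. Hence no one-edge at or before a gap is used. If the next
`w` is too dear, the whole path behaves in this way; the constant `2` covers the extra cost `1 + j
ε`, which is less than `2`. -/
theorem b_zeros (h : (counterGraph n r s t).IsOptimal F B) (hc : HasCopies F) (i : Fin n)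
    (j : Fin (r * s)) (hF : (∃ j', j ≤ j' ∧ CEdge.b1 i j' ∉ F) ∨
      val B (.uNext i) + 2 * 2 ^ (2 * (i.val + 1)) + 2 ≤ val B (.wNext i)) :
    val B (.b i j) = 2 * 2 ^ (2 * (i.val + 1)) + 1 +
      (j.val : ℝ) * (1 / ((r : ℝ) * s)) + val B (.uNext i) ∧ CEdge.b1 i j ∉ B := by
  induction hm : r * s - j.val using Nat.strong_induction_on generalizing j with
  | _ m ih =>
    have hj := j.2
    rcases val_b_cases h i j with ⟨h1, h2⟩ | ⟨h1, h2⟩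
    swap
    · exact ⟨h2, h1⟩
    exfalso
    have hle := val_b_le h hc i j
    rw [h2] at hle
    have hF' : (∃ j', j < j' ∧ CEdge.b1 i j' ∉ F) ∨
        -- The gap cannot lie at `j` itself, since the one-edge at `j` is used; so it survives for
        -- the next vertex of the path.
        val B (.uNext i) + 2 * 2 ^ (2 * (i.val + 1)) + 2 ≤ val B (.wNext i) := by
      refine hF.imp_left ?_
      rintro ⟨j', hj', hn⟩
      refine ⟨j', lt_of_le_of_ne hj' ?_, hn⟩
      rintro rfl
      exact hn (h.subset h1)
    simp only [CEdge.dst] at hle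
    split_ifs at hle with h3
    · have := (ih (r * s - (j.val + 1)) (by omega) ⟨j.val + 1, h3⟩
        (hF'.imp_left fun ⟨j', hj', hn⟩ => ⟨j', hj', hn⟩) rfl).1
      have h4 := mul_eps_lt_succ hj
      simp only at this
      linarith
    · rcases hF' with ⟨j', hj', -⟩ | hF'
      · have := j'.2
        have : j.val < j'.val := hj'
        omega
      · have := mul_eps_lt_one hj
        linarith

theorem a_ones (h : (counterGraph n r s t).IsOptimal F B) (i : Fin n) (j : Fin r)
    (hY : val B (.bFirst i) < val B (.uNext i) + 2 * 2 ^ (2 * (i.val + 1)))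
    (k : Fin s) (hF : ∀ k', k ≤ k' → CEdge.a1 i j k' ∈ F) :
    val B (.a i j k) = val B (.bFirst i) ∧ CEdge.a1 i j k ∈ B := by
  induction hm : s - k.val using Nat.strong_induction_on generalizing k with
  | _ m ih =>
    have hk := k.2
    have hd : val B (CEdge.a1 i j k : CEdge n r s t).dst = val B (.bFirst i) := by
      simp only [CEdge.dst]
      split_ifs with h1
      · exact (ih (s - (k.val + 1)) (by omega) ⟨k.val + 1, h1⟩
          (fun k' hk' => hF k' (le_trans (Fin.mk_le_mk.2 (Nat.le_succ _)) hk')) rfl).1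
      · rfl
    have hle := val_src_le h (hF k le_rfl)
    rw [hd] at hle
    simp only [CEdge.src, CEdge.cost, zero_add] at hle
    rcases val_a_cases h i j k with ⟨h1, h2⟩ | ⟨h1, h2⟩
    · exact ⟨h2.trans hd, h1⟩
    · have := mul_eps_nonneg (r := r) (s := s) k.val
      linarith

theorem a_zeros (h : (counterGraph n r s t).IsOptimal F B) (hc : HasCopies F) (i : Fin n)
    (j : Fin r) (k : Fin s) (hF : (∃ k', k ≤ k' ∧ CEdge.a1 i j k' ∉ F) ∨
      val B (.uNext i) + 2 * 2 ^ (2 * (i.val + 1)) + 1 ≤ val B (.bFirst i)) :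
    val B (.a i j k) = 2 * 2 ^ (2 * (i.val + 1)) +
      (k.val : ℝ) * (1 / ((r : ℝ) * s)) + val B (.uNext i) ∧ CEdge.a1 i j k ∉ B := by
  induction hm : s - k.val using Nat.strong_induction_on generalizing k with
  | _ m ih =>
    have hk := k.2
    have hk' : k.val < r * s := lt_of_lt_of_le hk (Nat.le_mul_of_pos_left s j.pos)
    rcases val_a_cases h i j k with ⟨h1, h2⟩ | ⟨h1, h2⟩
    swap
    · exact ⟨h2, h1⟩
    exfalso
    have hle := val_a_le h hc i j k
    rw [h2] at hle
    have hF' : (∃ k', k < k' ∧ CEdge.a1 i j k' ∉ F) ∨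
        val B (.uNext i) + 2 * 2 ^ (2 * (i.val + 1)) + 1 ≤ val B (.bFirst i) := by
      refine hF.imp_left ?_
      rintro ⟨k', hk', hn⟩
      refine ⟨k', lt_of_le_of_ne hk' ?_, hn⟩
      rintro rfl
      exact hn (h.subset h1)
    simp only [CEdge.dst] at hle
    split_ifs at hle with h3
    · have := (ih (s - (k.val + 1)) (by omega) ⟨k.val + 1, h3⟩
        (hF'.imp_left fun ⟨j', hj', hn⟩ => ⟨j', hj', hn⟩) rfl).1
      have h4 := mul_eps_lt_succ hk'
      simp only at this
      linarith
    · rcases hF' with ⟨j', hj', -⟩ | hF'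
      · have := j'.2
        have : k.val < j'.val := hj'
        omega
      · have := mul_eps_lt_one hk'
        linarith

end CounterGraph

/-! ### Bits of whole levels and how optimal trees react to one missing edge. -/

namespace CounterGraph

variable {n r s t : ℕ} {F B : Finset (CEdge n r s t)}

theorem HasCopies.erase_b1 (hc : HasCopies F) (i : Fin n) (j : Fin (r * s)) :
    HasCopies (F.erase (.b1 i j)) := by
  constructor <;> simp only [Finset.mem_erase, ne_eq, reduceCtorEq, not_false_eq_true, true_and]
  exacts [hc.a0, hc.b0, hc.u1, hc.u0, hc.wj, hc.w0]

theorem HasCopies.erase_a1 (hc : HasCopies F) (i : Fin n) (j : Fin r) (k : Fin s) :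
    HasCopies (F.erase (.a1 i j k)) := by
  constructor <;> simp only [Finset.mem_erase, ne_eq, reduceCtorEq, not_false_eq_true, true_and]
  exacts [hc.a0, hc.b0, hc.u1, hc.u0, hc.wj, hc.w0]

theorem bFirst_eq (h : 0 < r * s) (i : Fin n) :
    (CVertex.bFirst i : CVertex n r s) = .b i ⟨0, h⟩ :=
  dif_pos h

theorem aFirst_eq (h : 0 < s) (i : Fin n) (j : Fin r) :
    (CVertex.aFirst i j : CVertex n r s) = .a i j ⟨0, h⟩ :=
  dif_pos h

theorem bPath_of_isOptimal (h : (counterGraph n r s t).IsOptimal F B) {i : Fin n}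
    (hY : val B (.uNext i) = val B (.wNext i)) (hb : BPath F i) (j : Fin (r * s)) :
    val B (.b i j) = val B (.wNext i) ∧ CEdge.b1 i j ∈ B := by
  refine b_ones h i ?_ j fun j' _ => hb j'
  have : (0 : ℝ) < 2 ^ (2 * (i.val + 1)) := by positivity
  linarith

theorem aPath_of_isOptimal (h : (counterGraph n r s t).IsOptimal F B) (hrs : 0 < r * s)
    {i : Fin n} (hY : val B (.uNext i) = val B (.wNext i)) (hb : BPath F i) {j : Fin r}
    (ha : APath F i j) (k : Fin s) :
    val B (.a i j k) = val B (.wNext i) ∧ CEdge.a1 i j k ∈ B := by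
  have h1 : val B (.bFirst i) = val B (.wNext i) := by
    rw [bFirst_eq hrs]
    exact (bPath_of_isOptimal h hY hb _).1
  rw [← h1]
  refine a_ones h i j ?_ k fun k' _ => ha k'
  have : (0 : ℝ) < 2 ^ (2 * (i.val + 1)) := by positivity
  linarith

theorem val_aFirst_of_blocked (h : (counterGraph n r s t).IsOptimal F B) (hc : HasCopies F)
    (hs : 0 < s) {i : Fin n} {j : Fin r} (ha : ¬ APath F i j) :
    val B (.aFirst i j) = 2 * 2 ^ (2 * (i.val + 1)) + val B (.uNext i) := by
  rw [APath, not_forall] at ha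
  obtain ⟨k, hk⟩ := ha
  rw [aFirst_eq hs, (a_zeros h hc i j ⟨0, hs⟩ (Or.inl ⟨k, Nat.zero_le _, hk⟩)).1]
  simp

/-- The zero-edges of the `b`-path carry an extra cost `1`, while `k ε < 1` on an `a`-path. So once
the `b`-path is interrupted, every `a`-vertex prefers its own zero-edge. This makes the `a`-edges
leave the tree before the bit is set again. -/
theorem closed_level (h : (counterGraph n r s t).IsOptimal F B) (hc : HasCopies F)
    {i : Fin n} (hb : ¬ BPath F i) (j : Fin r) (k : Fin s) :
    val B (.a i j k) = 2 * 2 ^ (2 * (i.val + 1)) +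
      (k.val : ℝ) * (1 / ((r : ℝ) * s)) + val B (.uNext i) ∧ CEdge.a1 i j k ∉ B := by
  rw [BPath, not_forall] at hb
  obtain ⟨j₀, hj₀⟩ := hb
  have hrs : 0 < r * s := j₀.pos
  refine a_zeros h hc i j k (Or.inr ?_)
  rw [bFirst_eq hrs, (b_zeros h hc i ⟨0, hrs⟩ (Or.inl ⟨j₀, Nat.zero_le _, hj₀⟩)).1]
  simp only [CharP.cast_eq_zero, zero_mul, add_zero]
  linarith

/-- The level is not broken: its `b`-path is interrupted, or some `a`-path is not. -/
def Sound (F : Finset (CEdge n r s t)) (i : Fin n) : Prop :=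
  ¬ BPath F i ∨ ∃ j, APath F i j

/-- A set bit gives `u` and `w` both the cost of the next `w`; an unset bit adds the same cost `2 ^
(2 * (i + 1))` to both. In the first case an interrupted `a`-path does no harm, since it costs twice
that amount. -/
theorem Sound.val_eq (h : (counterGraph n r s t).IsOptimal F B) (hc : HasCopies F)
    (hrs : 0 < r * s) {i : Fin n} (hi : Sound F i)
    (hY : val B (.uNext i) = val B (.wNext i)) : val B (.u i) = val B (.w i) := by
  have hs : 0 < s := Nat.pos_of_mul_pos_left hrs
  have hL : (0 : ℝ) < 2 ^ (2 * (i.val + 1)) := by positivity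
  have hu := val_u_le h hc i
  have hw := val_w_le h hc i
  by_cases hb : BPath F i
  · obtain ⟨j, hj⟩ := hi.resolve_left (not_not.2 hb)
    have hbF : val B (.bFirst i) = val B (.wNext i) := by
      rw [bFirst_eq hrs]
      exact (bPath_of_isOptimal h hY hb _).1
    have hwj := hw.1 j
    rw [aFirst_eq hs, (aPath_of_isOptimal h hrs hY hb hj _).1] at hwj
    have hu' : val B (.u i) = val B (.wNext i) := by
      rcases val_u_cases h i with h1 | h1
      · rw [h1, hbF]
      · linarith [hu.1]
    have hw' : val B (.w i) = val B (.wNext i) := by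
      rcases val_w_cases h i with ⟨j', h1⟩ | h1
      · by_cases hj' : APath F i j'
        · rw [h1, aFirst_eq hs, (aPath_of_isOptimal h hrs hY hb hj' _).1]
        · rw [val_aFirst_of_blocked h hc hs hj'] at h1
          linarith
      · linarith
    rw [hu', hw']
  · have haF : ∀ j, val B (.aFirst i j) = 2 * 2 ^ (2 * (i.val + 1)) + val B (.uNext i) := by
      intro j
      rw [aFirst_eq hs, (closed_level h hc hb j _).1]
      simp
    have hbF : val B (.bFirst i) = 2 * 2 ^ (2 * (i.val + 1)) + 1 + val B (.uNext i) := by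
      rw [BPath, not_forall] at hb
      obtain ⟨j₀, hj₀⟩ := hb
      rw [bFirst_eq hrs, (b_zeros h hc i ⟨0, hrs⟩ (Or.inl ⟨j₀, Nat.zero_le _, hj₀⟩)).1]
      simp
    have hu' : val B (.u i) = 2 ^ (2 * (i.val + 1)) + val B (.uNext i) := by
      rcases val_u_cases h i with h1 | h1
      · linarith [hu.2]
      · exact h1
    have hw' : val B (.w i) = 2 ^ (2 * (i.val + 1)) + val B (.wNext i) := by
      rcases val_w_cases h i with ⟨j', h1⟩ | h1
      · rw [haF] at h1
        linarith [hw.2]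
      · exact h1
    rw [hu', hw', hY]

theorem val_uNext_eq (h : (counterGraph n r s t).IsOptimal F B) (hc : HasCopies F)
    (hrs : 0 < r * s) (i : Fin n) (hi : ∀ x, i < x → Sound F x) :
    val B (.uNext i) = val B (.wNext i) := by
  induction hm : n - i.val using Nat.strong_induction_on generalizing i with
  | _ m ih =>
    have := i.2
    unfold CVertex.uNext CVertex.wNext
    split_ifs with h1
    · have hlt : i < ⟨i.val + 1, h1⟩ := Nat.lt_succ_self _
      refine (hi _ hlt).val_eq h hc hrs ?_
      exact ih (n - (i.val + 1)) (by omega) ⟨i.val + 1, h1⟩ (fun x hx => hi x (hlt.trans hx)) rfl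
    · rfl

/-- `u` takes the free `b`-path, whereas `w` has to pay at least `2 ^ (2 * (i + 1))`, by its own
zero-edge or at the start of an interrupted `a`-path. -/
theorem broken_level (h : (counterGraph n r s t).IsOptimal F B) (hc : HasCopies F)
    (hrs : 0 < r * s) {i : Fin n} (hY : val B (.uNext i) = val B (.wNext i)) (hb : BPath F i)
    (ha : ∀ j, ¬ APath F i j) : val B (.u i) + 2 ^ (2 * (i.val + 1)) ≤ val B (.w i) := by
  have hs : 0 < s := Nat.pos_of_mul_pos_left hrs
  have hL : (0 : ℝ) < 2 ^ (2 * (i.val + 1)) := by positivity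
  have hu := (val_u_le h hc i).1
  rw [bFirst_eq hrs, (bPath_of_isOptimal h hY hb _).1] at hu
  rcases val_w_cases h i with ⟨j, h1⟩ | h1
  · rw [val_aFirst_of_blocked h hc hs (ha j)] at h1
    linarith
  · linarith

/-- With so large a gap above, `u` pays its zero-edge to the next `u`, while the cheapest way for
`w` is an `a`-zero-edge of twice that cost or the expensive next `w`. So a gap remains, and the
factor `4` between the costs of consecutive levels makes it just large enough for the level below.
-/
theorem reset_level (h : (counterGraph n r s t).IsOptimal F B) (hc : HasCopies F)
    (hrs : 0 < r * s) {i : Fin n}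
    (hY : val B (.uNext i) + 4 * 2 ^ (2 * (i.val + 1)) ≤ val B (.wNext i)) :
    val B (.u i) + 2 ^ (2 * (i.val + 1)) ≤ val B (.w i) ∧ ∀ j, CEdge.b1 i j ∉ B := by
  have hs : 0 < s := Nat.pos_of_mul_pos_left hrs
  have hL : (1 : ℝ) ≤ 2 ^ (2 * (i.val + 1)) := one_le_pow₀ (by norm_num)
  have hb := fun j => b_zeros h hc i j (Or.inr (by linarith))
  refine ⟨?_, fun j => (hb j).2⟩
  have hu := (val_u_le h hc i).2
  rcases val_w_cases h i with ⟨j, h1⟩ | h1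
  · have := (a_zeros h hc i j ⟨0, hs⟩ (Or.inr (by
      rw [bFirst_eq hrs, (hb _).1]
      simp only [CharP.cast_eq_zero, zero_mul, add_zero]
      linarith))).1
    rw [aFirst_eq hs, this] at h1
    simp only [CharP.cast_eq_zero, zero_mul, add_zero] at h1
    linarith
  · linarith

/-- A broken level resets the levels below it. -/
theorem reset_below (h : (counterGraph n r s t).IsOptimal F B) (hc : HasCopies F)
    (hrs : 0 < r * s) {i : Fin n}
    (hi : val B (.u i) + 2 ^ (2 * (i.val + 1)) ≤ val B (.w i)) (x : Fin n) (hx : x < i) :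
    val B (.u x) + 2 ^ (2 * (x.val + 1)) ≤ val B (.w x) ∧ ∀ j, CEdge.b1 x j ∉ B := by
  induction hm : i.val - x.val using Nat.strong_induction_on generalizing x with
  | _ m ih =>
    have hx' : x.val < i.val := hx
    have h1 : x.val + 1 < n := by omega
    refine reset_level h hc hrs ?_
    have h2 : val B (.u ⟨x.val + 1, h1⟩) + 2 ^ (2 * (x.val + 1 + 1)) ≤
        val B (.w ⟨x.val + 1, h1⟩) := by
      by_cases hxi : x.val + 1 = i.val
      · have : (⟨x.val + 1, h1⟩ : Fin n) = i := Fin.ext hxi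
        rw [this, hxi]
        exact hi
      · exact (ih (i.val - (x.val + 1)) (by omega) ⟨x.val + 1, h1⟩
          (show x.val + 1 < i.val by omega) rfl).1
    unfold CVertex.uNext CVertex.wNext
    rw [dif_pos h1, dif_pos h1]
    have h3 : (2 : ℝ) ^ (2 * (x.val + 1 + 1)) = 4 * 2 ^ (2 * (x.val + 1)) := by ring
    linarith

theorem bPath_erase_iff {i x : Fin n} {j : Fin (r * s)} (hx : x ≠ i) :
    BPath (F.erase (.b1 i j)) x ↔ BPath F x := by
  simp [BPath, Finset.mem_erase, hx]

theorem aPath_erase_b1_iff {i x : Fin n} {j : Fin (r * s)} {j' : Fin r} :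
    APath (F.erase (.b1 i j)) x j' ↔ APath F x j' := by
  simp [APath, Finset.mem_erase]

theorem bPath_erase_a1_iff {i x : Fin n} {j : Fin r} {k : Fin s} :
    BPath (F.erase (.a1 i j k)) x ↔ BPath F x := by
  simp [BPath, Finset.mem_erase]

theorem aPath_erase_a1_iff {i x : Fin n} {j j' : Fin r} {k : Fin s} (hx : x ≠ i) :
    APath (F.erase (.a1 i j k)) x j' ↔ APath F x j' := by
  simp [APath, Finset.mem_erase, hx]

theorem b1_mem_switch_b1 {i x : Fin n} {j : Fin (r * s)} {j' : Fin (r * s)} (hx : x ≠ i) :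
    CEdge.b1 x j' ∈ (counterGraph n r s t).switch B (.b1 i j) ↔ CEdge.b1 x j' ∈ B := by
  simp [PathInstance.mem_switch, counterGraph, CEdge.src, hx]

theorem a1_mem_switch_b1 {i x : Fin n} {j : Fin (r * s)} {j' : Fin r} {k : Fin s} :
    CEdge.a1 x j' k ∈ (counterGraph n r s t).switch B (.b1 i j) ↔ CEdge.a1 x j' k ∈ B := by
  simp [PathInstance.mem_switch, counterGraph, CEdge.src]

theorem b1_mem_switch_a1 {i x : Fin n} {j : Fin r} {k : Fin s} {j' : Fin (r * s)} :
    CEdge.b1 x j' ∈ (counterGraph n r s t).switch B (.a1 i j k) ↔ CEdge.b1 x j' ∈ B := by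
  simp [PathInstance.mem_switch, counterGraph, CEdge.src]

theorem a1_mem_switch_a1 {i x : Fin n} {j j' : Fin r} {k k' : Fin s} (hx : x ≠ i) :
    CEdge.a1 x j' k' ∈ (counterGraph n r s t).switch B (.a1 i j k) ↔ CEdge.a1 x j' k' ∈ B := by
  simp [PathInstance.mem_switch, counterGraph, CEdge.src, hx]

/-- What an optimal tree looks like after the last edge of a `b`-path has been added. -/
theorem switch_b1 (hrs : 0 < r * s) (hc : HasCopies F) {i : Fin n} {j : Fin (r * s)}
    (hb : BPath F i) (hx : ∀ x, x ≠ i → Sound F x)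
    (h : (counterGraph n r s t).IsOptimal (F.erase (.b1 i j)) B) :
    (counterGraph n r s t).Improving B (.b1 i j) ∧
    (∀ x, x ≠ i → BPath F x → BPath ((counterGraph n r s t).switch B (.b1 i j)) x ∧
      ∀ j', APath F x j' → APath ((counterGraph n r s t).switch B (.b1 i j)) x j') ∧
    ∀ j' k, CEdge.a1 i j' k ∉ (counterGraph n r s t).switch B (.b1 i j) := by
  have hc' := hc.erase_b1 i j
  have hsound : ∀ x, Sound (F.erase (.b1 i j)) x := by
    intro x
    by_cases hxi : x = i
    · subst hxi
      exact Or.inl fun h => by simpa using h j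
    · have := hx x hxi
      simpa only [Sound, bPath_erase_iff hxi, aPath_erase_b1_iff] using this
  have hY := fun x => val_uNext_eq h hc' hrs x fun y _ => hsound y
  refine ⟨?_, fun x hxi hbx => ⟨fun j' => ?_, fun j' ha k => ?_⟩, fun j' k => ?_⟩
  · have h1 := (b_zeros h hc' i j (Or.inl ⟨j, le_rfl, by simp⟩)).1
    have h2 : val B (CEdge.b1 i j : CEdge n r s t).dst = val B (.wNext i) := by
      simp only [CEdge.dst]
      split_ifs with h3
      · refine (b_ones h i ?_ _ fun j' hj' => Finset.mem_erase.2 ⟨?_, hb j'⟩).1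
        · have : (0 : ℝ) < 2 ^ (2 * (i.val + 1)) := by positivity
          linarith [hY i]
        · rintro h4
          have h5 : j.val + 1 ≤ j'.val := hj'
          simp only [CEdge.b1.injEq, true_and] at h4
          subst h4
          omega
      · rfl
    rw [h.isTree.improving_iff]
    change (CEdge.b1 i j : CEdge n r s t).cost + val B (CEdge.b1 i j : CEdge n r s t).dst <
      val B (.b i j)
    rw [h1, h2, ← hY]
    have : (0 : ℝ) < 2 ^ (2 * (i.val + 1)) := by positivity
    have := mul_eps_nonneg (r := r) (s := s) j.val
    simp only [CEdge.cost]
    linarith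
  · rw [b1_mem_switch_b1 hxi]
    exact (bPath_of_isOptimal h (hY x) ((bPath_erase_iff hxi).2 hbx) j').2
  · rw [a1_mem_switch_b1]
    exact (aPath_of_isOptimal h hrs (hY x) ((bPath_erase_iff hxi).2 hbx)
      (aPath_erase_b1_iff.2 ha) k).2
  · rw [a1_mem_switch_b1]
    exact (closed_level h hc' (fun h' => by simpa using h' j) j' k).2

/-- What an optimal tree looks like after the last edge that makes an `a`-path complete has been
added: the levels below have been reset. -/
theorem switch_a1 (hrs : 0 < r * s) (hc : HasCopies F) {i : Fin n} {j : Fin r} {k : Fin s}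
    (hb : BPath F i) (ha : APath F i j) (huniq : ∀ j', APath F i j' → j' = j)
    (hx : ∀ x, i < x → Sound F x)
    (h : (counterGraph n r s t).IsOptimal (F.erase (.a1 i j k)) B) :
    (counterGraph n r s t).Improving B (.a1 i j k) ∧
    (∀ x, i ≤ x → BPath F x → BPath ((counterGraph n r s t).switch B (.a1 i j k)) x) ∧
    (∀ x, i < x → BPath F x → ∀ j', APath F x j' →
      APath ((counterGraph n r s t).switch B (.a1 i j k)) x j') ∧
    ∀ x, x < i → ∀ j', CEdge.b1 x j' ∉ (counterGraph n r s t).switch B (.a1 i j k) := by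
  have hc' := hc.erase_a1 i j k
  have hs : 0 < s := Nat.pos_of_mul_pos_left hrs
  have hsound : ∀ x, i < x → Sound (F.erase (.a1 i j k)) x := by
    intro x hxi
    have := hx x hxi
    simpa only [Sound, bPath_erase_a1_iff, aPath_erase_a1_iff hxi.ne'] using this
  have hY : ∀ x, i ≤ x → val B (.uNext x) = val B (.wNext x) := fun x hix =>
    val_uNext_eq h hc' hrs x fun y hy => hsound y (hix.trans_lt hy)
  have hb' : BPath (F.erase (.a1 i j k)) i := bPath_erase_a1_iff.2 hb
  -- The erased edge lies on the only complete `a`-path, so without it the level is broken and the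
  -- levels below are reset.
  have hblocked : ∀ j', ¬ APath (F.erase (.a1 i j k)) i j' := by
    intro j' hj'
    obtain rfl := huniq j' fun k' => Finset.mem_of_mem_erase (hj' k')
    simpa using hj' k
  have hbF : val B (.bFirst i) = val B (.wNext i) := by
    rw [bFirst_eq hrs]
    exact (bPath_of_isOptimal h (hY i le_rfl) hb' _).1
  have hL : (0 : ℝ) < 2 ^ (2 * (i.val + 1)) := by positivity
  refine ⟨?_, fun x hix hbx j' => ?_, fun x hix hbx j' haj k' => ?_, fun x hxi j' => ?_⟩
  · have h1 := (a_zeros h hc' i j k (Or.inl ⟨k, le_rfl, by simp⟩)).1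
    have h2 : val B (CEdge.a1 i j k : CEdge n r s t).dst = val B (.wNext i) := by
      simp only [CEdge.dst]
      split_ifs with h3
      · rw [← hbF]
        refine (a_ones h i j ?_ _ fun j' hj' => Finset.mem_erase.2 ⟨?_, ha j'⟩).1
        · linarith [hY i le_rfl]
        · rintro h4
          have h5 : k.val + 1 ≤ j'.val := hj'
          simp only [CEdge.a1.injEq, true_and] at h4
          subst h4
          omega
      · exact hbF
    rw [h.isTree.improving_iff]
    change (CEdge.a1 i j k : CEdge n r s t).cost + val B (CEdge.a1 i j k : CEdge n r s t).dst <
      val B (.a i j k)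
    rw [h1, h2, ← hY i le_rfl]
    have := mul_eps_nonneg (r := r) (s := s) k.val
    simp only [CEdge.cost]
    linarith
  · rw [b1_mem_switch_a1]
    exact (bPath_of_isOptimal h (hY x hix) (bPath_erase_a1_iff.2 hbx) j').2
  · rw [a1_mem_switch_a1 hix.ne']
    exact (aPath_of_isOptimal h hrs (hY x hix.le) (bPath_erase_a1_iff.2 hbx)
      ((aPath_erase_a1_iff hix.ne').2 haj) k').2
  · rw [b1_mem_switch_a1]
    exact (reset_below h hc' hrs (broken_level h hc' hrs (hY i le_rfl) hb' hblocked) x hxi).2 j'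

end CounterGraph

/-! ### The states `Counting` and `Setting` and the transitions between them. -/

namespace CounterGraph

variable {n r s t : ℕ} {F B B' : Finset (CEdge n r s t)} {N : Finset (Fin n)}

/-- The levels above `i` are settled: their bits do not change any more. -/
def Settled (F B : Finset (CEdge n r s t)) (i : ℕ) : Prop :=
  ∀ x : Fin n, i < x.val → ¬ BPath F x ∨ (BPath B x ∧ ∃ j, APath B x j)

/-- The bits of the levels in `N` are active and have been reset; the bit of level `i` is set, and
its last `a`-path is about to be completed. -/
structure Counting (F B : Finset (CEdge n r s t)) (i : ℕ) (N : Finset (Fin n)) : Prop where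
  above : Settled F B i
  level : ∀ x : Fin n, x.val = i →
    BPath B x ∧ ∃ j, APath F x j ∧ ∀ j', APath F x j' → j' = j
  lt : ∀ x ∈ N, x.val < i
  active : ∀ x ∈ N, ∀ j, CEdge.b1 x j ∈ F ∧ CEdge.b1 x j ∉ B
  closed : ∀ x : Fin n, x.val < i → x ∉ N → ¬ BPath F x

/-- The bit of level `i` is being set, while the active bits of the levels below, which form the
set `N`, are still set. -/
structure Setting (F B : Finset (CEdge n r s t)) (i : Fin n) (N : Finset (Fin n)) : Prop where
  above : Settled F B i
  bPath : BPath F i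
  a1_notMem : ∀ j k, CEdge.a1 i j k ∉ B
  lt : ∀ x ∈ N, x < i
  active : ∀ x ∈ N, BPath B x ∧ ∀ j, APath F x j → APath B x j
  closed : ∀ x, x < i → x ∉ N → ¬ BPath F x

theorem BPath.mono {S S' : Finset (CEdge n r s t)} {x : Fin n} (h : BPath S x) (hS : S ⊆ S') :
    BPath S' x :=
  fun j => hS (h j)

theorem APath.mono {S S' : Finset (CEdge n r s t)} {x : Fin n} {j : Fin r} (h : APath S x j)
    (hS : S ⊆ S') : APath S' x j :=
  fun k => hS (h k)

theorem Settled.erase {i : ℕ} (h : Settled F B i) (e : CEdge n r s t) :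
    Settled (F.erase e) B i :=
  fun x hx => (h x hx).imp_left fun h' h'' => h' (h''.mono (Finset.erase_subset _ _))

theorem Settled.sound {i : ℕ} (h : Settled F B i) (hF : B ⊆ F) {x : Fin n} (hx : i < x.val) :
    Sound F x :=
  (h x hx).imp_right fun ⟨_, j, hj⟩ => ⟨j, hj.mono hF⟩

/-- In the first call after a pick from an active level, that level turns from active to closed and
nothing else changes. -/
theorem Counting.erase_active {i : ℕ} (h : Counting F B i N) {x : Fin n} (j : Fin (r * s))
    (hx : x ∈ N) : Counting (F.erase (.b1 x j)) B i (N.erase x) where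
  above := h.above.erase _
  level := by
    intro y hy
    simpa only [aPath_erase_b1_iff] using h.level y hy
  lt := fun y hy => h.lt y (Finset.mem_of_mem_erase hy)
  active := by
    intro y hy j'
    rw [Finset.mem_erase] at hy
    refine ⟨Finset.mem_erase.2 ⟨fun he => hy.1 ?_, (h.active y hy.2 j').1⟩, (h.active y hy.2 j').2⟩
    simp only [CEdge.b1.injEq] at he
    exact he.1
  closed := by
    intro y hy hyN hb
    by_cases hyx : y = x
    · subst hyx
      simpa using hb j
    · exact h.closed y hy (fun h' => hyN (Finset.mem_erase.2 ⟨hyx, h'⟩))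
        (hb.mono (Finset.erase_subset _ _))

theorem Counting.erase {i : ℕ} (h : Counting F B i N) {e : CEdge n r s t}
    (hb : ∀ x ∈ N, ∀ j, e ≠ .b1 x j)
    (ha : ∀ x : Fin n, x.val = i → ∀ j, APath F x j → ∀ k, e ≠ .a1 x j k) :
    Counting (F.erase e) B i N where
  above := h.above.erase _
  level := by
    intro y hy
    obtain ⟨h1, j, hj, hu⟩ := h.level y hy
    exact ⟨h1, j, fun k => Finset.mem_erase.2 ⟨(ha y hy j hj k).symm, hj k⟩,
      fun j' hj' => hu j' (hj'.mono (Finset.erase_subset _ _))⟩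
  lt := h.lt
  active := fun y hy j =>
    ⟨Finset.mem_erase.2 ⟨(hb y hy j).symm, (h.active y hy j).1⟩, (h.active y hy j).2⟩
  closed := fun y hy hyN hb => h.closed y hy hyN (hb.mono (Finset.erase_subset _ _))

/-- Only the `b`-path of level `i` is at risk. Erasing an `a`-edge may reduce the complete
`a`-paths, but those that remain in `F` at an active level are still in `B`. -/
theorem Setting.erase {i : Fin n} (h : Setting F B i N) {e : CEdge n r s t}
    (hb : ∀ j, e ≠ .b1 i j) : Setting (F.erase e) B i N where
  above := h.above.erase _
  bPath := fun j => Finset.mem_erase.2 ⟨(hb j).symm, h.bPath j⟩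
  a1_notMem := h.a1_notMem
  lt := h.lt
  active := fun y hy => ⟨(h.active y hy).1, fun j hj =>
    (h.active y hy).2 j (hj.mono (Finset.erase_subset _ _))⟩
  closed := fun y hy hyN hb => h.closed y hy hyN (hb.mono (Finset.erase_subset _ _))

/-- Without the picked edge every level is sound, so the first call returns a tree in which every
other level with a complete `b`-path has its bit set. The levels above `x` are thereby settled, and
only the active levels below `x` remain available for counting. -/
theorem Counting.switch_b1 {i : ℕ} (h : Counting F B i N) (hrs : 0 < r * s) (hF : B ⊆ F)
    (hc : HasCopies F) (hN : ∀ x ∈ N, ∃ j, APath F x j) {x : Fin n} {j : Fin (r * s)}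
    (hx : x ∈ N) (hopt : (counterGraph n r s t).IsOptimal (F.erase (.b1 x j)) B') :
    (counterGraph n r s t).Improving B' (.b1 x j) ∧
      Setting F ((counterGraph n r s t).switch B' (.b1 x j)) x {y ∈ N | y < x} := by
  have hsound : ∀ y, Sound F y := by
    intro y
    rcases lt_trichotomy y.val i with hy | hy | hy
    · by_cases hyN : y ∈ N
      · exact Or.inr (hN y hyN)
      · exact Or.inl (h.closed y hy hyN)
    · exact Or.inr ((h.level y hy).2.imp fun _ h => h.1)
    · exact h.above.sound hF hy
  obtain ⟨h1, h2, h3⟩ := CounterGraph.switch_b1 hrs hc (fun j => (h.active x hx j).1)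
    (fun y _ => hsound y) hopt
  refine ⟨h1, ?_, fun j => (h.active x hx j).1, h3, fun y hy => (Finset.mem_filter.1 hy).2,
    fun y hy => ?_, fun y hy hyN => ?_⟩
  · intro y hy
    have hyx : y ≠ x := fun h => by simp [h] at hy
    by_cases hb : BPath F y
    · obtain ⟨j', hj'⟩ := (hsound y).resolve_left (not_not.2 hb)
      exact Or.inr ⟨(h2 y hyx hb).1, j', (h2 y hyx hb).2 j' hj'⟩
    · exact Or.inl hb
  · rw [Finset.mem_filter] at hy
    exact h2 y hy.2.ne fun j => (h.active y hy.1 j).1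
  · exact h.closed y (lt_trans hy (h.lt x hx)) fun h' => hyN (Finset.mem_filter.2 ⟨h', hy⟩)

/-- A missing `b`-edge of the level that is being set may be picked too. It is re-inserted after the
first call, and the state is as before. -/
theorem Setting.switch_b1 {i : Fin n} (h : Setting F B i N) (hrs : 0 < r * s) (hF : B ⊆ F)
    (hc : HasCopies F) (hN : ∀ x ∈ N, ∃ j, APath F x j) {j : Fin (r * s)}
    (hopt : (counterGraph n r s t).IsOptimal (F.erase (.b1 i j)) B') :
    (counterGraph n r s t).Improving B' (.b1 i j) ∧
      Setting F ((counterGraph n r s t).switch B' (.b1 i j)) i N := by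
  have hsound : ∀ y, y ≠ i → Sound F y := by
    intro y hyi
    rcases lt_or_gt_of_ne hyi with hy | hy
    · by_cases hyN : y ∈ N
      · exact Or.inr (hN y hyN)
      · exact Or.inl (h.closed y hy hyN)
    · exact h.above.sound hF hy
  obtain ⟨h1, h2, h3⟩ := CounterGraph.switch_b1 hrs hc h.bPath hsound hopt
  refine ⟨h1, ?_, h.bPath, h3, h.lt, fun y hy => ?_, h.closed⟩
  · intro y hy
    have hyx : y ≠ i := fun h => by simp [h] at hy
    by_cases hb : BPath F y
    · obtain ⟨j', hj'⟩ := (hsound y hyx).resolve_left (not_not.2 hb)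
      exact Or.inr ⟨(h2 y hyx hb).1, j', (h2 y hyx hb).2 j' hj'⟩
    · exact Or.inl hb
  · exact h2 y (h.lt y hy).ne ((h.active y hy).1.mono hF)

/-- This is the common core of two transitions: completing the level that has just been set, and
repairing the last `a`-path of a level whose bit is set already. In both, the first call sees a
broken level and resets everything below it. -/
theorem counting_of_switch_a1 (hrs : 0 < r * s) (hF : B ⊆ F) (hc : HasCopies F) {i : Fin n}
    {j : Fin r} {k : Fin s} (habove : Settled F B i) (hb : BPath F i) (ha : APath F i j)
    (huniq : ∀ j', APath F i j' → j' = j) (hlt : ∀ x ∈ N, x < i) (hact : ∀ x ∈ N, BPath F x)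
    (hclosed : ∀ x, x < i → x ∉ N → ¬ BPath F x)
    (hopt : (counterGraph n r s t).IsOptimal (F.erase (.a1 i j k)) B') :
    (counterGraph n r s t).Improving B' (.a1 i j k) ∧
      Counting F ((counterGraph n r s t).switch B' (.a1 i j k)) i N := by
  obtain ⟨h1, h2, h3, h4⟩ := switch_a1 hrs hc hb ha huniq
    (fun y hy => habove.sound hF hy) hopt
  refine ⟨h1, ?_, ?_, hlt, fun y hy j' => ⟨hact y hy j', h4 y (hlt y hy) j'⟩, hclosed⟩
  · intro y hy
    by_cases hby : BPath F y
    · obtain ⟨j', hj'⟩ := (habove.sound hF hy).resolve_left (not_not.2 hby)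
      exact Or.inr ⟨h2 y (le_of_lt hy) hby, j', h3 y hy hby j' hj'⟩
    · exact Or.inl hby
  · intro y hy
    obtain rfl := Fin.ext hy
    exact ⟨h2 y le_rfl hb, j, ha, huniq⟩

theorem Counting.switch_a1 {i : Fin n} (h : Counting F B i N) (hrs : 0 < r * s) (hF : B ⊆ F)
    (hc : HasCopies F) {j : Fin r} {k : Fin s} (ha : APath F i j)
    (hopt : (counterGraph n r s t).IsOptimal (F.erase (.a1 i j k)) B') :
    (counterGraph n r s t).Improving B' (.a1 i j k) ∧
      Counting F ((counterGraph n r s t).switch B' (.a1 i j k)) i N := by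
  obtain ⟨h1, j₀, -, hu⟩ := h.level i rfl
  refine counting_of_switch_a1 hrs hF hc h.above (h1.mono hF) ha ?_ h.lt
    (fun x hx j => (h.active x hx j).1) h.closed hopt
  intro j' hj'
  rw [hu j' hj', hu j ha]

theorem Setting.switch_a1 {i : Fin n} (h : Setting F B i N) (hrs : 0 < r * s) (hF : B ⊆ F)
    (hc : HasCopies F) {j : Fin r} {k : Fin s} (ha : APath F i j)
    (huniq : ∀ j', APath F i j' → j' = j)
    (hopt : (counterGraph n r s t).IsOptimal (F.erase (.a1 i j k)) B') :
    (counterGraph n r s t).Improving B' (.a1 i j k) ∧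
      Counting F ((counterGraph n r s t).switch B' (.a1 i j k)) i N :=
  counting_of_switch_a1 hrs hF hc h.above h.bPath ha huniq h.lt
    (fun x hx => (h.active x hx).1.mono hF) h.closed hopt

/-- The start is a counting state with a fictitious set bit above the top level: with `i = n` the
conditions on level `i` and on the levels above are vacuous. -/
theorem counting_univ {B₀ : Finset (CEdge n r s t)} (h0 : ∀ e ∈ B₀, e.IsZero) :
    Counting Finset.univ B₀ n Finset.univ where
  above := fun x hx => absurd x.2 (by omega)
  level := fun x hx => absurd x.2 (by omega)
  lt := fun x _ => x.2
  active := fun x _ j => ⟨Finset.mem_univ _, fun h => h0 _ h⟩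
  closed := fun x _ hx => absurd (Finset.mem_univ x) hx

end CounterGraph

/-! ### Weights that measure the danger of losing copies or `a`-paths. -/

/-- A pick multiplies `p ^ q F` by at most `p⁻¹`, and only picks from `Z` change it at all. -/
theorem sum_pow_erase_sub_le {E : Type} [DecidableEq E] {p : ℝ} (hp : 0 < p) (hp1 : p ≤ 1)
    (q : Finset E → ℕ) (F T Z : Finset E) (h1 : ∀ e, q F ≤ q (F.erase e) + 1)
    (h2 : ∀ e, e ∉ Z → q (F.erase e) = q F) :
    ∑ e ∈ T, (p ^ q (F.erase e) - p ^ q F) ≤ (Z.card : ℝ) * (p⁻¹ * p ^ q F) := by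
  have hle : ∀ e, p ^ q (F.erase e) - p ^ q F ≤ p⁻¹ * p ^ q F := by
    intro e
    have h3 : p ^ (q (F.erase e) + 1) ≤ p ^ q F := pow_le_pow_of_le_one hp.le hp1 (h1 e)
    have h4 : p ^ q (F.erase e) ≤ p⁻¹ * p ^ q F := by
      rw [le_inv_mul_iff₀ hp]
      linarith [pow_succ' p (q (F.erase e))]
    have : 0 < p ^ q F := by positivity
    linarith
  calc ∑ e ∈ T, (p ^ q (F.erase e) - p ^ q F)
      = ∑ e ∈ T ∩ Z, (p ^ q (F.erase e) - p ^ q F) := by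
        refine (Finset.sum_subset Finset.inter_subset_left fun e he heZ => ?_).symm
        rw [h2 e fun h => heZ (Finset.mem_inter.2 ⟨he, h⟩), sub_self]
    _ ≤ ∑ e ∈ T ∩ Z, p⁻¹ * p ^ q F := Finset.sum_le_sum fun e _ => hle e
    _ = ((T ∩ Z).card : ℝ) * (p⁻¹ * p ^ q F) := by rw [Finset.sum_const, nsmul_eq_mul]
    _ ≤ (Z.card : ℝ) * (p⁻¹ * p ^ q F) := by
        gcongr
        exact Finset.inter_subset_right

/-- Counting a bit at `y` discards all levels from `y` upwards. Restricting the counted bits to the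
top `g` levels limits this loss to `g`. -/
theorem exists_top_subset {α : Type} [LinearOrder α] (N : Finset α) (g : ℕ) (hg : g ≤ N.card) :
    ∃ T ⊆ N, T.card = g ∧ ∀ y ∈ T, N.card ≤ (N.filter (· < y)).card + g := by
  induction g generalizing N with
  | zero => exact ⟨∅, Finset.empty_subset _, rfl, fun y hy => absurd hy (Finset.notMem_empty y)⟩
  | succ g ih =>
    have hne : N.Nonempty := Finset.card_pos.1 (by omega)
    have hm := N.max'_mem hne
    have hc := Finset.card_erase_of_mem hm
    obtain ⟨T, hT, hTc, hTy⟩ := ih (N.erase (N.max' hne)) (by omega)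
    have hmT : N.max' hne ∉ T := fun h => by simpa using hT h
    refine ⟨insert (N.max' hne) T, ?_, by rw [Finset.card_insert_of_notMem hmT, hTc], ?_⟩
    · exact Finset.insert_subset hm (hT.trans (Finset.erase_subset _ _))
    · intro y hy
      rcases Finset.mem_insert.1 hy with rfl | hy
      · have : N.erase (N.max' hne) ⊆ N.filter (· < N.max' hne) := by
          intro z hz
          rw [Finset.mem_erase] at hz
          exact Finset.mem_filter.2 ⟨hz.2, lt_of_le_of_ne (N.le_max' z hz.2) hz.1⟩
        have := Finset.card_le_card this
        omega
      · have h1 := hTy y hy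
        have h2 : ((N.erase (N.max' hne)).filter (· < y)).card ≤ (N.filter (· < y)).card :=
          Finset.card_le_card (Finset.filter_subset_filter _ (Finset.erase_subset _ _))
        omega

namespace CounterGraph

/-- The multi-edges of `G_{n,r,s,t}`. -/
inductive MultiEdge (n r s : ℕ) : Type
  | a0 (i : Fin n) (j : Fin r) (k : Fin s)
  | b0 (i : Fin n) (j : Fin (r * s))
  | u1 (i : Fin n)
  | u0 (i : Fin n)
  | wj (i : Fin n) (j : Fin r)
  | w0 (i : Fin n)
  deriving DecidableEq, Fintype

variable {n r s t : ℕ} {F B : Finset (CEdge n r s t)} {N : Finset (Fin n)}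

/-- The `l`-th copy of a multi-edge. -/
def MultiEdge.copy : MultiEdge n r s → Fin t → CEdge n r s t
  | a0 i j k, l => .a0 i j k l
  | b0 i j, l => .b0 i j l
  | u1 i, l => .u1 i l
  | u0 i, l => .u0 i l
  | wj i j, l => .wj i j l
  | w0 i, l => .w0 i l

theorem MultiEdge.copy_injective (m : MultiEdge n r s) :
    Function.Injective (m.copy : Fin t → CEdge n r s t) := by
  intro l l' h
  cases m <;> simpa [copy] using h

/-- The number of copies of a multi-edge in `F`. -/
def copies (m : MultiEdge n r s) (F : Finset (CEdge n r s t)) : ℕ :=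
  (Finset.univ.filter fun l => m.copy l ∈ F).card

open Classical in
/-- The number of `a`-paths of level `x` in `F`. -/
noncomputable def freePaths (x : Fin n) (F : Finset (CEdge n r s t)) : ℕ :=
  (Finset.univ.filter fun j => APath F x j).card

theorem copies_erase_le (m : MultiEdge n r s) (F : Finset (CEdge n r s t)) (e : CEdge n r s t) :
    copies m (F.erase e) ≤ copies m F :=
  Finset.card_le_card fun l => by
    simp only [Finset.mem_filter, Finset.mem_univ, true_and]
    exact Finset.mem_of_mem_erase

theorem copies_le_erase_add_one (m : MultiEdge n r s) (F : Finset (CEdge n r s t))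
    (e : CEdge n r s t) : copies m F ≤ copies m (F.erase e) + 1 := by
  by_cases he : ∃ l, m.copy l = e
  · obtain ⟨l, rfl⟩ := he
    rw [copies, copies]
    refine le_trans (Finset.card_le_card ?_) (Finset.card_insert_le l _)
    intro l' hl'
    simp only [Finset.mem_filter, Finset.mem_univ, true_and, Finset.mem_insert,
      Finset.mem_erase] at hl' ⊢
    by_cases h : l' = l
    · exact Or.inl h
    · exact Or.inr ⟨fun h' => h (m.copy_injective h'), hl'⟩
  · refine le_trans (Finset.card_le_card fun l hl => ?_) (Nat.le_succ _)
    simp only [Finset.mem_filter, Finset.mem_univ, true_and, Finset.mem_erase] at hl ⊢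
    exact ⟨fun h => he ⟨l, h⟩, hl⟩

theorem copies_erase_of_notMem (m : MultiEdge n r s) (F : Finset (CEdge n r s t))
    (e : CEdge n r s t) (he : e ∉ Finset.univ.image (m.copy : Fin t → CEdge n r s t)) :
    copies m (F.erase e) = copies m F := by
  have : ∀ l, m.copy l ≠ e := fun l h => he (Finset.mem_image.2 ⟨l, Finset.mem_univ _, h⟩)
  simp [copies, Finset.mem_erase, this]

theorem freePaths_pos {x : Fin n} : 0 < freePaths x F ↔ ∃ j, APath F x j := by
  classical
  simp [freePaths, Finset.card_pos, Finset.filter_nonempty_iff]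

theorem freePaths_le (x : Fin n) (F : Finset (CEdge n r s t)) : freePaths x F ≤ r := by
  classical
  exact (Finset.card_le_univ _).trans_eq (Fintype.card_fin r)

theorem freePaths_erase_of_forall_ne {x : Fin n} {e : CEdge n r s t}
    (h : ∀ j, APath F x j → ∀ k, e ≠ .a1 x j k) : freePaths x (F.erase e) = freePaths x F := by
  classical
  rw [freePaths, freePaths]
  congr 1
  ext j
  simp only [Finset.mem_filter, Finset.mem_univ, true_and]
  exact ⟨fun h' => h'.mono (Finset.erase_subset _ _),
    fun h' k => Finset.mem_erase.2 ⟨(h j h' k).symm, h' k⟩⟩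

theorem freePaths_erase_a1 {x : Fin n} {j : Fin r} (h : APath F x j) (k : Fin s) :
    freePaths x (F.erase (.a1 x j k)) + 1 = freePaths x F := by
  classical
  have h1 : (Finset.univ.filter fun j' => APath (F.erase (.a1 x j k)) x j') =
      (Finset.univ.filter fun j' => APath F x j').erase j := by
    ext j'
    simp only [Finset.mem_filter, Finset.mem_univ, true_and, Finset.mem_erase]
    constructor
    · refine fun h' => ⟨?_, h'.mono (Finset.erase_subset _ _)⟩
      rintro rfl
      simpa using h' k
    · rintro ⟨h1, h2⟩ k'
      exact Finset.mem_erase.2 ⟨fun h' => h1 (by simp only [CEdge.a1.injEq] at h'; exact h'.2.1),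
        h2 k'⟩
  rw [freePaths, freePaths, h1]
  exact Finset.card_erase_add_one (by simpa using h)

theorem freePaths_erase (x : Fin n) (F : Finset (CEdge n r s t)) (e : CEdge n r s t) :
    freePaths x (F.erase e) ≤ freePaths x F ∧ freePaths x F ≤ freePaths x (F.erase e) + 1 := by
  by_cases h : ∃ j, APath F x j ∧ ∃ k, e = .a1 x j k
  · obtain ⟨j, hj, k, rfl⟩ := h
    have := freePaths_erase_a1 hj k
    omega
  · push Not at h
    have := freePaths_erase_of_forall_ne h
    omega

/-- The sum of `p` to the number of copies, over all multi-edges. -/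
noncomputable def copyWeight (p : ℝ) (F : Finset (CEdge n r s t)) : ℝ :=
  ∑ m : MultiEdge n r s, p ^ copies m F

/-- The sum of `p` to the number of complete `a`-paths, over the levels in `N`. -/
noncomputable def pathWeight (p : ℝ) (N : Finset (Fin n)) (F : Finset (CEdge n r s t)) : ℝ :=
  ∑ x ∈ N, p ^ freePaths x F

variable {p : ℝ}

theorem copyWeight_nonneg (hp : 0 < p) (F : Finset (CEdge n r s t)) : 0 ≤ copyWeight p F :=
  Finset.sum_nonneg fun _ _ => by positivity

theorem pathWeight_nonneg (hp : 0 < p) (N : Finset (Fin n)) (F : Finset (CEdge n r s t)) :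
    0 ≤ pathWeight p N F :=
  Finset.sum_nonneg fun _ _ => by positivity

theorem copyWeight_le_erase (hp : 0 < p) (hp1 : p ≤ 1) (F : Finset (CEdge n r s t))
    (e : CEdge n r s t) : copyWeight p F ≤ copyWeight p (F.erase e) :=
  Finset.sum_le_sum fun m _ => pow_le_pow_of_le_one hp.le hp1 (copies_erase_le m F e)

theorem pathWeight_le_erase (hp : 0 < p) (hp1 : p ≤ 1) (N : Finset (Fin n))
    (F : Finset (CEdge n r s t)) (e : CEdge n r s t) :
    pathWeight p N F ≤ pathWeight p N (F.erase e) :=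
  Finset.sum_le_sum fun x _ => pow_le_pow_of_le_one hp.le hp1 (freePaths_erase x F e).1

theorem pathWeight_mono (hp : 0 < p) {N N' : Finset (Fin n)} (h : N ⊆ N')
    (F : Finset (CEdge n r s t)) : pathWeight p N F ≤ pathWeight p N' F :=
  Finset.sum_le_sum_of_subset_of_nonneg h fun _ _ _ => by positivity

/-- A multi-edge without copies alone contributes `p ^ 0 = 1`. -/
theorem hasCopies_of_copyWeight_lt_one (hp : 0 < p) (h : copyWeight p F < 1) : HasCopies F := by
  have key : ∀ m : MultiEdge n r s, ∃ l, m.copy l ∈ F := by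
    intro m
    by_contra! hm
    have h0 : copies m F = 0 := by simp [copies, hm]
    have h1 : p ^ copies m F ≤ copyWeight p F :=
      Finset.single_le_sum (f := fun m => p ^ copies m F) (fun _ _ => by positivity)
        (Finset.mem_univ m)
    rw [h0, pow_zero] at h1
    linarith
  exact ⟨fun i j k => key (.a0 i j k), fun i j => key (.b0 i j), fun i => key (.u1 i),
    fun i => key (.u0 i), fun i j => key (.wj i j), fun i => key (.w0 i)⟩

theorem exists_aPath_of_pathWeight_lt_one (hp : 0 < p) (h : pathWeight p N F < 1) {x : Fin n}
    (hx : x ∈ N) : ∃ j, APath F x j := by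
  rw [← freePaths_pos]
  by_contra h0
  have h1 : p ^ freePaths x F ≤ pathWeight p N F :=
    Finset.single_le_sum (f := fun x => p ^ freePaths x F) (fun _ _ => by positivity) hx
  rw [Nat.eq_zero_of_not_pos h0, pow_zero] at h1
  linarith

theorem sum_copyWeight_erase_sub_le (hp : 0 < p) (hp1 : p ≤ 1) (F T : Finset (CEdge n r s t)) :
    ∑ e ∈ T, (copyWeight p (F.erase e) - copyWeight p F) ≤ (t : ℝ) * (p⁻¹ * copyWeight p F) := by
  simp only [copyWeight, ← Finset.sum_sub_distrib]
  rw [Finset.sum_comm, Finset.mul_sum, Finset.mul_sum]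
  refine Finset.sum_le_sum fun m _ => ?_
  have h := sum_pow_erase_sub_le hp hp1 (copies m) F T (Finset.univ.image m.copy)
    (copies_le_erase_add_one m F) (copies_erase_of_notMem m F)
  rwa [Finset.card_image_of_injective _ m.copy_injective, Finset.card_univ,
    Fintype.card_fin] at h

theorem sum_pathWeight_erase_sub_le (hp : 0 < p) (hp1 : p ≤ 1) (N : Finset (Fin n))
    (F T : Finset (CEdge n r s t)) :
    ∑ e ∈ T, (pathWeight p N (F.erase e) - pathWeight p N F) ≤
      ((r * s : ℕ) : ℝ) * (p⁻¹ * pathWeight p N F) := by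
  simp only [pathWeight, ← Finset.sum_sub_distrib]
  rw [Finset.sum_comm, Finset.mul_sum, Finset.mul_sum]
  refine Finset.sum_le_sum fun x _ => ?_
  have h := sum_pow_erase_sub_le hp hp1 (freePaths x) F T
    (Finset.univ.image fun jk : Fin r × Fin s => CEdge.a1 x jk.1 jk.2)
    (fun e => (freePaths_erase x F e).2) (fun e he => freePaths_erase_of_forall_ne fun j _ k h =>
      he (Finset.mem_image.2 ⟨(j, k), Finset.mem_univ _, h.symm⟩))
  refine h.trans ?_
  gcongr
  exact Finset.card_image_le.trans_eq (by simp)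

end CounterGraph

/-! ### Potential functions and the induction along the calls. -/

namespace CounterGraph

variable {n r s t : ℕ}

/-- The parameters of the potential functions: `p` weighs the edges that may get lost, `K` and `η`
are the discounts per counted bit and per interrupted `a`-path, `S` is the number of levels that may
be lost without being counted, and `g` is the number of levels that are candidates for a bit. -/
structure Params (n r s t : ℕ) where
  p : ℝ
  K : ℝ
  η : ℝ
  S : ℝ
  g : ℕ
  p_pos : 0 < p
  p_le : p ≤ 1
  one_le_K : 1 ≤ K
  one_le_η : 1 ≤ η
  S_pos : 0 < S
  g_pos : 0 < g
  rs_pos : 0 < r * s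
  counting_drift : (4 * n / S + p⁻¹) * (r * s : ℕ) + t * p⁻¹ ≤ g * (r * s : ℕ) * (1 - K⁻¹)
  setting_drift : t * p⁻¹ ≤ s * (1 - η⁻¹)

namespace Params

variable (P : Params n r s t)

/-- The potential while `k + 1` more bits are to be set, the next of them in `x` ways. -/
noncomputable def countingValue (k x : ℕ) (h : ℝ) (N : Finset (Fin n))
    (F : Finset (CEdge n r s t)) : ℝ :=
  x * 2 ^ k * (1 - P.K ^ (2 * k + x) * (1 / 4 + h / P.S + pathWeight P.p N F +
    P.η ^ (r * (k + 1)) * copyWeight P.p F))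

/-- The potential while a bit of a level with `q` complete `a`-paths is being set and `k` more bits
are to be set thereafter. -/
noncomputable def settingValue (k q : ℕ) (h : ℝ) (N : Finset (Fin n))
    (F : Finset (CEdge n r s t)) : ℝ :=
  2 ^ k * (1 - P.K ^ (2 * k) * (1 / 4 + h / P.S + pathWeight P.p N F +
    P.η ^ (r * k + q) * copyWeight P.p F))

/-- The potential functions bound the expected number of switches from below. -/
def Bound (F B : Finset (CEdge n r s t)) : Prop :=
  (∀ (i : ℕ) (N : Finset (Fin n)) (k x : ℕ) (h : ℝ), Counting F B i N → 0 ≤ h →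
    (P.g : ℝ) * (k + 1) + P.S ≤ N.card + h → ENNReal.ofReal (P.countingValue k x h N F) ≤
      1 + expectedSwitches (counterGraph n r s t) F B) ∧
  ∀ (i : Fin n) (N : Finset (Fin n)) (k : ℕ) (h : ℝ), Setting F B i N → 0 ≤ h →
    (P.g : ℝ) * k + P.S ≤ N.card + h → (∃ j, APath F i j) →
    ENNReal.ofReal (P.settingValue k (freePaths i F) h N F) ≤
      1 + expectedSwitches (counterGraph n r s t) F B

variable {P} {F B : Finset (CEdge n r s t)} {N : Finset (Fin n)}

/-- A nonpositive potential bounds nothing, so only positive ones matter. There the discount, whose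
factors are at least `1`, stays below `1`, and so does each of its summands: no failure has occurred
yet, and fewer than `S` levels have been lost. -/
theorem weights_lt_one {c h m : ℝ} {k q : ℕ} (hc : 0 < c) (h0 : 0 ≤ h)
    (hpos : 0 < c * (1 - P.K ^ k * (1 / 4 + h / P.S + pathWeight P.p N F +
      P.η ^ q * copyWeight P.p F))) (hm : m + P.S ≤ N.card + h) :
    HasCopies F ∧ (∀ x ∈ N, ∃ j, APath F x j) ∧ m < N.card := by
  have h1 := pos_of_mul_pos_right hpos hc.le
  have h2 := copyWeight_nonneg P.p_pos F
  have h3 := pathWeight_nonneg P.p_pos N F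
  have h4 : 1 ≤ P.K ^ k := one_le_pow₀ P.one_le_K
  have h5 : copyWeight P.p F ≤ P.η ^ q * copyWeight P.p F :=
    le_mul_of_one_le_left h2 (one_le_pow₀ P.one_le_η)
  have h6 : 0 ≤ h / P.S := div_nonneg h0 P.S_pos.le
  have h7 : 1 / 4 + h / P.S + pathWeight P.p N F + P.η ^ q * copyWeight P.p F < 1 := by
    refine lt_of_le_of_lt (le_mul_of_one_le_left ?_ h4) (sub_pos.1 h1)
    linarith
  refine ⟨hasCopies_of_copyWeight_lt_one P.p_pos (by linarith),
    fun x => exists_aPath_of_pathWeight_lt_one P.p_pos (by linarith), ?_⟩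
  have h8 : h / P.S < 1 := by linarith
  rw [div_lt_one P.S_pos] at h8
  linarith

theorem inv_η_le : P.η⁻¹ ≤ 1 := inv_le_one_of_one_le₀ P.one_le_η

/-- The value of counting a bit and of continuing without it. -/
theorem counting_split {k x : ℕ} {h dP dC : ℝ} {w c : ℝ} (hw : 0 ≤ w) (hc : 0 ≤ c) (hh : 0 ≤ h)
    (hdP : 0 ≤ dP) (hdC : 0 ≤ dC) {w' w'' : ℝ} (hw' : w' ≤ w + dP) (hw'' : w'' ≤ w) {q : ℕ}
    (hq : q ≤ r) :
    (x + 1 : ℕ) * 2 ^ k * (1 - P.K ^ (2 * k + (x + 1)) * (1 / 4 + h / P.S + w +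
        P.η ^ (r * (k + 1)) * c)) -
      (x + 1 : ℕ) * 2 ^ k * P.K ^ (2 * k + (x + 1)) * (1 / P.S + dP +
        P.η ^ (r * (k + 1)) * dC) +
      (x + 1 : ℕ) * 2 ^ k * P.K ^ (2 * k + (x + 1)) * (1 / 4 + h / P.S + w +
        P.η ^ (r * (k + 1)) * c) * (1 - P.K⁻¹) ≤
    x * 2 ^ k * (1 - P.K ^ (2 * k + x) * (1 / 4 + (h + 1) / P.S + w' +
        P.η ^ (r * (k + 1)) * (c + dC))) +
      2 ^ k * (1 - P.K ^ (2 * k) * (1 / 4 + h / P.S + w'' + P.η ^ (r * k + q) * c)) := by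
  have hK0 : 0 < P.K := lt_of_lt_of_le one_pos P.one_le_K
  have hη0 : 0 < P.η := lt_of_lt_of_le one_pos P.one_le_η
  have hS := P.S_pos
  set H := P.η ^ (r * (k + 1)) with hH
  have hH0 : 0 < H := by positivity
  -- The new bit has at most `r` complete `a`-paths, so the `r` factors `η` reserved for one
  -- generation suffice.
  have hHq : P.η ^ (r * k + q) ≤ H := by
    refine pow_le_pow_right₀ P.one_le_η ?_
    rw [Nat.mul_succ]
    omega
  set d := 1 / P.S + dP + H * dC with hd
  have hd0 : 0 ≤ d := by positivity
  set W := 1 / 4 + h / P.S + w + H * c with hW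
  have hW0 : 0 ≤ W := by positivity
  set K1 := P.K ^ (2 * k + x) with hK1
  have hK10 : 0 < K1 := by positivity
  -- Both successors carry at most the factor `K1`, one factor `K` less than the current state. This
  -- saving is the term with `1 - K⁻¹`.
  have hK2 : P.K ^ (2 * k + (x + 1)) = K1 * P.K := by rw [← add_assoc, pow_succ]
  have hK3 : P.K ^ (2 * k) ≤ K1 := pow_le_pow_right₀ P.one_le_K (by omega)
  have hA : 1 / 4 + (h + 1) / P.S + w' + H * (c + dC) ≤ W + d := by
    rw [hW, hd, add_div]
    linarith
  have hB : 1 / 4 + h / P.S + w'' + P.η ^ (r * k + q) * c ≤ W + d := by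
    have := mul_le_mul_of_nonneg_right hHq hc
    linarith
  have h2k : (0 : ℝ) < 2 ^ k := by positivity
  have hA' : (x : ℝ) * 2 ^ k * (1 - K1 * (W + d)) ≤
      x * 2 ^ k * (1 - K1 * (1 / 4 + (h + 1) / P.S + w' + H * (c + dC))) := by gcongr
  have hB' : (2 : ℝ) ^ k * (1 - K1 * (W + d)) ≤
      2 ^ k * (1 - P.K ^ (2 * k) * (1 / 4 + h / P.S + w'' + P.η ^ (r * k + q) * c)) := by
    have h1 : P.K ^ (2 * k) * (1 / 4 + h / P.S + w'' + P.η ^ (r * k + q) * c) ≤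
        P.K ^ (2 * k) * (W + d) := by gcongr
    have h2 : P.K ^ (2 * k) * (W + d) ≤ K1 * (W + d) := by gcongr
    exact mul_le_mul_of_nonneg_left (by linarith) h2k.le
  refine le_trans ?_ (add_le_add hA' hB')
  rw [hK2]
  push_cast
  have hKi : P.K * (1 - P.K⁻¹) = P.K - 1 := by field_simp
  have e1 : ((x : ℝ) + 1) * 2 ^ k * (K1 * P.K) * W * (1 - P.K⁻¹) =
      (x + 1) * 2 ^ k * K1 * W * (P.K - 1) := by rw [← hKi]; ring
  rw [e1]
  have : 0 ≤ ((x : ℝ) + 1) * 2 ^ k * K1 * d * (P.K - 1) := by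
    have := P.one_le_K
    have : 0 ≤ P.K - 1 := by linarith
    positivity
  nlinarith [this]

theorem counting_step (hB : (counterGraph n r s t).IsTree B) (hF : B ⊆ F)
    (ihl : ∀ e ∈ F \ B, P.Bound (F.erase e) B)
    (ihr : ∀ B', (counterGraph n r s t).IsTree B' → B' ⊆ F →
      (counterGraph n r s t).Better B' B → P.Bound F B')
    {i k x : ℕ} {h : ℝ} (hcount : Counting F B i N) (h0 : 0 ≤ h)
    (hN : (P.g : ℝ) * (k + 1) + P.S ≤ N.card + h) :
    ENNReal.ofReal (P.countingValue k x h N F) ≤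
      1 + expectedSwitches (counterGraph n r s t) F B := by
  classical
  by_cases hpos : P.countingValue k x h N F ≤ 0
  · rw [ENNReal.ofReal_of_nonpos hpos]
    exact zero_le
  rw [not_le] at hpos
  -- With `x = 0` no more bits are counted here and the potential vanishes.
  obtain _ | x := x
  · simp [countingValue] at hpos
  have hx2 : (0 : ℝ) < ((x + 1 : ℕ) : ℝ) * 2 ^ k := by positivity
  obtain ⟨hcopies, hpaths, hcard⟩ := weights_lt_one hx2 h0 hpos hN
  have hgN : P.g ≤ N.card := by
    have : (P.g : ℝ) ≤ P.g * (k + 1) := le_mul_of_one_le_right (by positivity)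
      (by linarith [Nat.cast_nonneg (α := ℝ) k])
    exact_mod_cast this.trans hcard.le
  obtain ⟨T, hTN, hTg, hT⟩ := exists_top_subset N P.g hgN
  have hrs := P.rs_pos
  have hK0 : 0 < P.K := lt_of_lt_of_le one_pos P.one_le_K
  have hη0 : 0 < P.η := lt_of_lt_of_le one_pos P.one_le_η
  have hS := P.S_pos
  -- the edges of the `b`-paths of a set of levels
  let Z : Finset (Fin n) → Finset (CEdge n r s t) := fun M =>
    (M ×ˢ Finset.univ).image fun xj => CEdge.b1 xj.1 xj.2
  have hZ : ∀ M e, e ∈ Z M ↔ ∃ y ∈ M, ∃ j, e = .b1 y j := by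
    intro M e
    simp only [Z, Finset.mem_image, Finset.mem_product, Finset.mem_univ, and_true, Prod.exists]
    exact ⟨fun ⟨y, j, hy, he⟩ => ⟨y, hy, j, he.symm⟩, fun ⟨y, hy, j, he⟩ => ⟨y, j, hy, he.symm⟩⟩
  have hZc : ∀ M, (Z M).card = M.card * (r * s) := by
    intro M
    rw [Finset.card_image_of_injective, Finset.card_product, Finset.card_univ, Fintype.card_fin]
    rintro ⟨y, j⟩ ⟨y', j'⟩ hh
    simpa using hh
  have hZF : ∀ M, M ⊆ N → Z M ⊆ F \ B := by
    intro M hM e he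
    obtain ⟨y, hy, j, rfl⟩ := (hZ M e).1 he
    exact Finset.mem_sdiff.2 (hcount.active y (hM hy) j)
  set W := 1 / 4 + h / P.S + pathWeight P.p N F + P.η ^ (r * (k + 1)) * copyWeight P.p F with hW
  set D := ((x + 1 : ℕ) : ℝ) * 2 ^ k * P.K ^ (2 * k + (x + 1)) with hD
  have hD0 : 0 < D := by positivity
  have hPW := pathWeight_nonneg P.p_pos N F
  have hCW := copyWeight_nonneg P.p_pos F
  -- This is the purpose of the summand `1 / 4`: the additive loss `1 / S` of a level becomes at
  -- most `4 / S` times `W`, so that it can be compared with a gain proportional to `W`.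
  have hW0 : 1 / 4 ≤ W := by
    have : 0 ≤ h / P.S := by positivity
    have : 0 ≤ P.η ^ (r * (k + 1)) * copyWeight P.p F := by positivity
    linarith
  have hΦ : P.countingValue k (x + 1) h N F = ((x + 1 : ℕ) : ℝ) * 2 ^ k - D * W := by
    rw [countingValue, ← hW, hD]
    ring
  let dP : CEdge n r s t → ℝ := fun e => pathWeight P.p N (F.erase e) - pathWeight P.p N F
  let dC : CEdge n r s t → ℝ := fun e => copyWeight P.p (F.erase e) - copyWeight P.p F
  have hdP : ∀ e, 0 ≤ dP e := fun e => sub_nonneg.2 (pathWeight_le_erase P.p_pos P.p_le N F e)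
  have hdC : ∀ e, 0 ≤ dC e := fun e => sub_nonneg.2 (copyWeight_le_erase P.p_pos P.p_le F e)
  have hloss : ∀ e, 0 ≤ D * (dP e + P.η ^ (r * (k + 1)) * dC e) := fun e => by
    have := hdP e
    have := hdC e
    positivity
  have hne : F ≠ B := by
    rintro rfl
    have h1 := Finset.card_le_card (hZF T hTN)
    rw [hZc, hTg, Finset.sdiff_self, Finset.card_empty] at h1
    have := Nat.mul_pos P.g_pos hrs
    omega
  -- Each pick is charged with its increase of the discount; the `g * (r * s)` picks from the top
  -- levels are credited with the saved factor `K`.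
  refine CompTree.ofReal_le_one_add_expectedSwitches isRanked hB hF hne
    (φ := fun e => P.countingValue k (x + 1) h N F -
      D * ((if e ∈ Z N then 1 / P.S else 0) + dP e + P.η ^ (r * (k + 1)) * dC e) +
      if e ∈ Z T then D * W * (1 - P.K⁻¹) else 0) ?_ ?_
  · rw [Finset.sum_add_distrib, Finset.sum_sub_distrib, Finset.sum_const, nsmul_eq_mul,
      ← Finset.mul_sum, Finset.sum_add_distrib, Finset.sum_add_distrib, ← Finset.mul_sum,
      ← Finset.sum_filter, ← Finset.sum_filter, Finset.sum_const, Finset.sum_const,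
      nsmul_eq_mul, nsmul_eq_mul, Finset.filter_mem_eq_inter, Finset.filter_mem_eq_inter,
      Finset.inter_eq_right.2 (hZF N subset_rfl), Finset.inter_eq_right.2 (hZF T hTN), hZc, hZc,
      hTg]
    have h1 := sum_pathWeight_erase_sub_le P.p_pos P.p_le N F (F \ B)
    have h2 := sum_copyWeight_erase_sub_le P.p_pos P.p_le F (F \ B)
    have h3 : (N.card : ℝ) ≤ n := by
      exact_mod_cast (Finset.card_le_univ N).trans_eq (Fintype.card_fin n)
    have hrs0 : (0 : ℝ) < (r * s : ℕ) := by exact_mod_cast hrs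
    have hp0 := P.p_pos
    have h4 : ((N.card * (r * s) : ℕ) : ℝ) * (1 / P.S) ≤ 4 * n / P.S * (r * s : ℕ) * W := by
      rw [Nat.cast_mul]
      calc (N.card : ℝ) * (r * s : ℕ) * (1 / P.S) ≤ n * (r * s : ℕ) * (1 / P.S) := by gcongr
        _ = 4 * n / P.S * (r * s : ℕ) * (1 / 4) := by ring
        _ ≤ _ := by gcongr
    have h5 : ∑ e ∈ F \ B, dP e ≤ (r * s : ℕ) * (P.p⁻¹ * W) := by
      refine h1.trans ?_
      gcongr
      have : 0 ≤ h / P.S := by positivity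
      have : 0 ≤ P.η ^ (r * (k + 1)) * copyWeight P.p F := by positivity
      linarith
    have h6 : P.η ^ (r * (k + 1)) * ∑ e ∈ F \ B, dC e ≤ t * (P.p⁻¹ * W) := by
      have h7 : P.η ^ (r * (k + 1)) * ∑ e ∈ F \ B, dC e ≤
          P.η ^ (r * (k + 1)) * (t * (P.p⁻¹ * copyWeight P.p F)) := by gcongr
      refine h7.trans ?_
      have h8 : P.η ^ (r * (k + 1)) * copyWeight P.p F ≤ W := by
        have : 0 ≤ h / P.S := by positivity
        linarith
      calc P.η ^ (r * (k + 1)) * (t * (P.p⁻¹ * copyWeight P.p F)) =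
            t * (P.p⁻¹ * (P.η ^ (r * (k + 1)) * copyWeight P.p F)) := by ring
        _ ≤ _ := by gcongr
    -- `counting_drift` says that the total credit covers the total charge: lost levels, interrupted
    -- `a`-paths and lost copies.
    have h9 := mul_le_mul_of_nonneg_left P.counting_drift (mul_nonneg hD0.le (by linarith : 0 ≤ W))
    have h10 : D * (((N.card * (r * s) : ℕ) : ℝ) * (1 / P.S) + ∑ e ∈ F \ B, dP e +
        P.η ^ (r * (k + 1)) * ∑ e ∈ F \ B, dC e) ≤
        D * (4 * n / P.S * (r * s : ℕ) * W + (r * s : ℕ) * (P.p⁻¹ * W) + t * (P.p⁻¹ * W)) := by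
      gcongr
    have h11 : ((P.g * (r * s) : ℕ) : ℝ) * (D * W * (1 - P.K⁻¹)) =
        D * W * (P.g * (r * s : ℕ) * (1 - P.K⁻¹)) := by
      rw [Nat.cast_mul]
      ring
    rw [h11]
    linarith
  · intro e he
    have heF := Finset.mem_sdiff.1 he
    by_cases heN : e ∈ Z N
    · obtain ⟨y, hy, j, rfl⟩ := (hZ N e).1 heN
      have hcN : ((N.erase y).card : ℝ) + 1 = N.card := by
        exact_mod_cast Finset.card_erase_add_one hy
      have hl := fun x' => (ihl _ he).1 i (N.erase y) k x' (h + 1) (hcount.erase_active j hy)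
        (by linarith) (by linarith)
      have hpw : pathWeight P.p (N.erase y) (F.erase (.b1 y j)) ≤
          pathWeight P.p N F + dP (.b1 y j) := by
        simp only [dP, add_sub_cancel]
        exact pathWeight_mono P.p_pos (Finset.erase_subset _ _) _
      by_cases heT : (CEdge.b1 y j : CEdge n r s t) ∈ Z T
      · have hyT : y ∈ T := by
          obtain ⟨y', hy', j', hj'⟩ := (hZ T _).1 heT
          simp only [CEdge.b1.injEq] at hj'
          rw [hj'.1]
          exact hy'
        -- A counted bit: of the `x + 1` units, `x` stay with the first call and one passes to the
        -- second, which starts to set level `y`.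
        refine ⟨P.countingValue k x (h + 1) (N.erase y) (F.erase (.b1 y j)),
          P.settingValue k (freePaths y F) h {z ∈ N | z < y} F, ?_, hl x, Or.inr ?_⟩
        · have hcw : copyWeight P.p (F.erase (.b1 y j)) = copyWeight P.p F + dC (.b1 y j) := by
            simp only [dC, add_sub_cancel]
          rw [if_pos heN, if_pos heT, countingValue, countingValue, settingValue, hcw]
          have := counting_split (P := P) (k := k) (x := x) hPW hCW h0 (hdP _)
            (hdC (.b1 y j)) hpw
            (pathWeight_mono P.p_pos (Finset.filter_subset (· < y) N) F) (freePaths_le y F)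
          simpa only [hD, hW] using this
        · intro B' hB'
          obtain ⟨hi, hset⟩ := hcount.switch_b1 hrs hF hcopies hpaths hy hB'
          refine ⟨hi, fun hbet => ?_⟩
          refine (ihr _ (isRanked.isTree_switch hB'.isTree _) (PathInstance.switch_subset
            (hB'.subset.trans (Finset.erase_subset _ _)) heF.1) hbet).2 y _ k h hset h0 ?_
            (hpaths y hy)
          have h1 : (N.card : ℝ) ≤ ({z ∈ N | z < y}.card : ℝ) + P.g := by exact_mod_cast hT y hyT
          linarith
      -- A bit below the top `g` levels would leave too few active levels, so its second call is
      -- ignored and the level is only recorded as lost.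
      · refine ⟨P.countingValue k (x + 1) (h + 1) (N.erase y) (F.erase (.b1 y j)), 0, ?_,
          hl _, Or.inl le_rfl⟩
        rw [if_pos heN, if_neg heT, hΦ, countingValue, add_zero, add_zero]
        have h1 : 1 / 4 + (h + 1) / P.S + pathWeight P.p (N.erase y) (F.erase (.b1 y j)) +
            P.η ^ (r * (k + 1)) * copyWeight P.p (F.erase (.b1 y j)) ≤
            W + (1 / P.S + dP (.b1 y j) + P.η ^ (r * (k + 1)) * dC (.b1 y j)) := by
          rw [hW, add_div]
          have : copyWeight P.p (F.erase (.b1 y j)) = copyWeight P.p F + dC (.b1 y j) := by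
            simp only [dC, add_sub_cancel]
          rw [this, mul_add]
          linarith
        have h2 := mul_le_mul_of_nonneg_left h1 hD0.le
        refine le_of_le_of_eq ?_ (by rw [hD]; ring :
          ((x + 1 : ℕ) : ℝ) * 2 ^ k - D * (1 / 4 + (h + 1) / P.S +
            pathWeight P.p (N.erase y) (F.erase (.b1 y j)) +
            P.η ^ (r * (k + 1)) * copyWeight P.p (F.erase (.b1 y j))) = _)
        linarith
    · have heT : e ∉ Z T := fun hT' => heN <| by
        obtain ⟨y, hy, j, hj⟩ := (hZ T e).1 hT'
        exact (hZ N e).2 ⟨y, hTN hy, j, hj⟩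
      rw [if_neg heN, if_neg heT, zero_add, add_zero]
      by_cases hea : ∃ (y : Fin n) (j : Fin r) (l : Fin s), y.val = i ∧ APath F y j ∧
          e = .a1 y j l
      · obtain ⟨y, j, l, rfl, hj, rfl⟩ := hea
        -- Here the first call sees a broken level and is ignored; the second call restores the same
        -- state with all of `F`.
        refine ⟨0, P.countingValue k (x + 1) h N F, by linarith [hloss (.a1 y j l)],
          by simp, Or.inr fun B' hB' => ?_⟩
        obtain ⟨hi, hset⟩ := hcount.switch_a1 hrs hF hcopies hj hB'
        exact ⟨hi, fun hbet => (ihr _ (isRanked.isTree_switch hB'.isTree _)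
          (PathInstance.switch_subset (hB'.subset.trans (Finset.erase_subset _ _)) heF.1)
          hbet).1 _ N k (x + 1) h hset h0 hN⟩
      · refine ⟨P.countingValue k (x + 1) h N (F.erase e), 0, ?_,
          (ihl e he).1 i N k (x + 1) h (hcount.erase (fun y hy j hej => heN
            ((hZ N e).2 ⟨y, hy, j, hej⟩)) fun y hy j hj l hel => hea ⟨y, j, l, hy, hj, hel⟩) h0 hN,
          Or.inl le_rfl⟩
        rw [countingValue, countingValue]
        simp only [dP, dC, hD]
        apply le_of_eq
        ring

theorem setting_step (hB : (counterGraph n r s t).IsTree B) (hF : B ⊆ F)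
    (ihl : ∀ e ∈ F \ B, P.Bound (F.erase e) B)
    (ihr : ∀ B', (counterGraph n r s t).IsTree B' → B' ⊆ F →
      (counterGraph n r s t).Better B' B → P.Bound F B')
    {i : Fin n} {k : ℕ} {h : ℝ} (hset : Setting F B i N) (h0 : 0 ≤ h)
    (hN : (P.g : ℝ) * k + P.S ≤ N.card + h) (hi : ∃ j, APath F i j) :
    ENNReal.ofReal (P.settingValue k (freePaths i F) h N F) ≤
      1 + expectedSwitches (counterGraph n r s t) F B := by
  classical
  by_cases hpos : P.settingValue k (freePaths i F) h N F ≤ 0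
  · rw [ENNReal.ofReal_of_nonpos hpos]
    exact zero_le
  rw [not_le] at hpos
  obtain ⟨hcopies, hpaths, hcard⟩ := weights_lt_one (by positivity) h0 hpos hN
  have hrs := P.rs_pos
  have hs : 0 < s := Nat.pos_of_mul_pos_left hrs
  have hK0 : 0 < P.K := lt_of_lt_of_le one_pos P.one_le_K
  have hη0 : 0 < P.η := lt_of_lt_of_le one_pos P.one_le_η
  have hS := P.S_pos
  have hPW := pathWeight_nonneg P.p_pos N F
  have hCW := copyWeight_nonneg P.p_pos F
  -- With no further bits to count, the potential is at most `1`, and the bound is trivial.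
  obtain _ | k := k
  · refine le_trans ?_ (le_add_of_nonneg_right zero_le)
    rw [← ENNReal.ofReal_one]
    refine ENNReal.ofReal_le_ofReal ?_
    have : 0 ≤ P.η ^ (r * 0 + freePaths i F) * copyWeight P.p F := by positivity
    have : 0 ≤ h / P.S := by positivity
    rw [settingValue]
    simp only [pow_zero, mul_zero, one_mul] at *
    linarith
  set q := freePaths i F with hq
  have hq1 : 1 ≤ q := freePaths_pos.2 hi
  let Z : Finset (CEdge n r s t) :=
    ((Finset.univ.filter fun j => APath F i j) ×ˢ (Finset.univ : Finset (Fin s))).image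
      fun jl => CEdge.a1 i jl.1 jl.2
  have hZ : ∀ e, e ∈ Z ↔ ∃ j, APath F i j ∧ ∃ l, e = .a1 i j l := by
    intro e
    simp only [Z, Finset.mem_image, Finset.mem_product, Finset.mem_univ, and_true, Prod.exists,
      Finset.mem_filter, true_and]
    exact ⟨fun ⟨j, l, hj, he⟩ => ⟨j, hj, l, he.symm⟩, fun ⟨j, hj, l, he⟩ => ⟨j, l, hj, he.symm⟩⟩
  have hZc : Z.card = q * s := by
    rw [Finset.card_image_of_injective, Finset.card_product, Finset.card_univ, Fintype.card_fin]
    · rfl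
    · rintro ⟨y, j⟩ ⟨y', j'⟩ hh
      simpa using hh
  have hZF : Z ⊆ F \ B := by
    intro e he
    obtain ⟨j, hj, l, rfl⟩ := (hZ e).1 he
    exact Finset.mem_sdiff.2 ⟨hj l, hset.a1_notMem j l⟩
  set H := P.η ^ (r * (k + 1) + q) with hH
  have hH0 : 0 < H := by positivity
  set D := (2 : ℝ) ^ (k + 1) * P.K ^ (2 * (k + 1)) with hD
  have hD0 : 0 < D := by positivity
  -- During this phase the complete `a`-paths of the active levels lie in `B`, so they cannot be
  -- picked and `pathWeight` does not change.
  have hpw : ∀ e ∈ F \ B, pathWeight P.p N (F.erase e) = pathWeight P.p N F := by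
    intro e he
    refine Finset.sum_congr rfl fun y hy => ?_
    rw [freePaths_erase_of_forall_ne]
    rintro j hj l rfl
    exact (Finset.mem_sdiff.1 he).2 ((hset.active y hy).2 j hj l)
  let dC : CEdge n r s t → ℝ := fun e => copyWeight P.p (F.erase e) - copyWeight P.p F
  have hdC : ∀ e, 0 ≤ dC e := fun e => sub_nonneg.2 (copyWeight_le_erase P.p_pos P.p_le F e)
  have hcw : ∀ e, copyWeight P.p (F.erase e) = copyWeight P.p F + dC e := fun e => by
    simp only [dC, add_sub_cancel]
  have hloss : ∀ e, 0 ≤ D * (H * dC e) := fun e => by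
    have := hdC e
    positivity
  have hne : F ≠ B := by
    rintro rfl
    have h1 := Finset.card_le_card hZF
    rw [hZc, Finset.sdiff_self, Finset.card_empty] at h1
    have := Nat.mul_pos hq1 hs
    omega
  refine CompTree.ofReal_le_one_add_expectedSwitches isRanked hB hF hne
    (φ := fun e => P.settingValue (k + 1) q h N F - D * (H * dC e) +
      if e ∈ Z then D * (H * copyWeight P.p F) * (1 - P.η⁻¹) else 0) ?_ ?_
  · rw [Finset.sum_add_distrib, Finset.sum_sub_distrib, Finset.sum_const, nsmul_eq_mul,
      ← Finset.mul_sum, ← Finset.mul_sum, ← Finset.sum_filter, Finset.sum_const,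
      nsmul_eq_mul, Finset.filter_mem_eq_inter, Finset.inter_eq_right.2 hZF, hZc]
    have h2 := sum_copyWeight_erase_sub_le P.p_pos P.p_le F (F \ B)
    have h3 : D * (H * ∑ e ∈ F \ B, dC e) ≤ D * (H * (t * (P.p⁻¹ * copyWeight P.p F))) := by
      gcongr
    -- The `s` edges of a single complete `a`-path already yield enough credit to pay for the lost
    -- copies.
    have h4 := mul_le_mul_of_nonneg_left P.setting_drift
      (show 0 ≤ D * (H * copyWeight P.p F) by positivity)
    have hη1 : 0 ≤ 1 - P.η⁻¹ := sub_nonneg.2 inv_η_le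
    have h5 : (s : ℝ) * (D * (H * copyWeight P.p F) * (1 - P.η⁻¹)) ≤
        ((q * s : ℕ) : ℝ) * (D * (H * copyWeight P.p F) * (1 - P.η⁻¹)) := by
      have : (s : ℝ) ≤ (q * s : ℕ) := by exact_mod_cast Nat.le_mul_of_pos_left s hq1
      gcongr
    linarith
  · intro e he
    have heF := Finset.mem_sdiff.1 he
    by_cases heZ : e ∈ Z
    · obtain ⟨j, hj, l, rfl⟩ := (hZ e).1 heZ
      have hval : P.settingValue (k + 1) q h N F - D * (H * dC (.a1 i j l)) +
          D * (H * copyWeight P.p F) * (1 - P.η⁻¹) ≤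
          P.settingValue (k + 1) (q - 1) h N (F.erase (.a1 i j l)) := by
        have hH1 : P.η ^ (r * (k + 1) + (q - 1)) = H * P.η⁻¹ := by
          rw [hH, ← Nat.sub_add_cancel hq1, Nat.add_sub_cancel, ← add_assoc, pow_succ]
          field_simp
        have h1 : D * (H * (dC (.a1 i j l) * P.η⁻¹)) ≤ D * (H * (dC (.a1 i j l) * 1)) := by
          have := hdC (.a1 i j l)
          have := inv_η_le (P := P)
          gcongr
        rw [settingValue, settingValue, hpw _ he, hcw, hH1, ← hH]
        refine le_of_sub_nonneg (le_of_le_of_eq (sub_nonneg.2 h1) ?_)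
        rw [hD]
        ring
      rw [if_pos heZ]
      -- Hitting the last complete `a`-path ends the phase. The value `2 ^ (k + 1)` then reappears
      -- as two bits worth `2 ^ k` each, with the same exponent `2 * k + 2` of `K`.
      by_cases hq2 : q = 1
      · have huniq : ∀ j', APath F i j' → j' = j := by
          intro j' hj'
          rw [hq, freePaths] at hq2
          exact Finset.card_le_one.1 hq2.le j' (by simpa using hj') j (by simpa using hj)
        refine ⟨0, P.countingValue k 2 h N F, ?_, by simp, Or.inr fun B' hB' => ?_⟩
        · refine hval.trans (le_trans ?_ (zero_add _).ge)
          have hpos' : 0 ≤ D * (P.η ^ (r * (k + 1)) * dC (.a1 i j l)) := by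
            have := hdC (.a1 i j l)
            positivity
          rw [settingValue, countingValue, hq2, hpw _ he, hcw]
          refine le_of_sub_nonneg (le_of_le_of_eq hpos' ?_)
          rw [hD]
          push_cast
          ring
        · obtain ⟨hi', hcount⟩ := hset.switch_a1 hrs hF hcopies hj huniq hB'
          refine ⟨hi', fun hbet => (ihr _ (isRanked.isTree_switch hB'.isTree _)
            (PathInstance.switch_subset (hB'.subset.trans (Finset.erase_subset _ _)) heF.1)
            hbet).1 _ N k 2 h hcount h0 ?_⟩
          push_cast at hN
          exact hN
      · have hfree := freePaths_erase_a1 hj l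
        have hfree' : freePaths i (F.erase (.a1 i j l)) = q - 1 := by omega
        refine ⟨_, 0, hval.trans (add_zero _).ge, ?_, Or.inl le_rfl⟩
        rw [← hfree']
        exact (ihl _ he).2 i N (k + 1) h (hset.erase (by simp)) h0 hN
          (freePaths_pos.1 (by omega))
    · rw [if_neg heZ, add_zero]
      by_cases heb : ∃ j, e = .b1 i j
      · obtain ⟨j, rfl⟩ := heb
        refine ⟨0, P.settingValue (k + 1) q h N F, by linarith [hloss (.b1 i j)],
          by simp, Or.inr fun B' hB' => ?_⟩
        obtain ⟨hi', hset'⟩ := hset.switch_b1 hrs hF hcopies hpaths hB'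
        exact ⟨hi', fun hbet => (ihr _ (isRanked.isTree_switch hB'.isTree _)
          (PathInstance.switch_subset (hB'.subset.trans (Finset.erase_subset _ _)) heF.1)
          hbet).2 i N (k + 1) h hset' h0 hN hi⟩
      · have hfree : freePaths i (F.erase e) = q := freePaths_erase_of_forall_ne
          fun j hj l hel => heZ ((hZ e).2 ⟨j, hj, l, hel⟩)
        refine ⟨P.settingValue (k + 1) q h N (F.erase e), 0, ?_, ?_, Or.inl le_rfl⟩
        · rw [settingValue, settingValue, hpw _ he, hcw, ← hH, hD]
          apply le_of_eq
          ring
        · rw [← hfree]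
          exact (ihl e he).2 i N (k + 1) h (hset.erase fun j hj => heb ⟨j, hj⟩) h0 hN
            (freePaths_pos.1 (by omega))

variable (P) in
theorem bound (hB : (counterGraph n r s t).IsTree B) (hF : B ⊆ F) : P.Bound F B :=
  PathInstance.tree_induction (P := P.Bound) (fun _ _ hB hF ihl ihr =>
    ⟨fun _ _ _ _ _ h1 h2 h3 => counting_step hB hF ihl ihr h1 h2 h3,
      fun _ _ _ _ h1 h2 h3 h4 => setting_step hB hF ihl ihr h1 h2 h3 h4⟩) hB hF

end Params

end CounterGraph

/-! ### Edge counts and the choice of the parameters. -/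

namespace CounterGraph

variable {n r s t : ℕ}

/-- The edges of `G_{n,r,s,t}`, sorted by their kinds. -/
def edgeEquiv (n r s t : ℕ) : CEdge n r s t ≃
    (Fin n × Fin r × Fin s) ⊕ (Fin n × Fin r × Fin s × Fin t) ⊕ (Fin n × Fin (r * s)) ⊕
    (Fin n × Fin (r * s) × Fin t) ⊕ (Fin n × Fin t) ⊕ (Fin n × Fin t) ⊕
    (Fin n × Fin r × Fin t) ⊕ (Fin n × Fin t) where
  toFun
    | .a1 i j k => .inl (i, j, k)
    | .a0 i j k l => .inr (.inl (i, j, k, l))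
    | .b1 i j => .inr (.inr (.inl (i, j)))
    | .b0 i j l => .inr (.inr (.inr (.inl (i, j, l))))
    | .u1 i l => .inr (.inr (.inr (.inr (.inl (i, l)))))
    | .u0 i l => .inr (.inr (.inr (.inr (.inr (.inl (i, l))))))
    | .wj i j l => .inr (.inr (.inr (.inr (.inr (.inr (.inl (i, j, l)))))))
    | .w0 i l => .inr (.inr (.inr (.inr (.inr (.inr (.inr (i, l)))))))
  invFun
    | .inl (i, j, k) => .a1 i j k
    | .inr (.inl (i, j, k, l)) => .a0 i j k l
    | .inr (.inr (.inl (i, j))) => .b1 i j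
    | .inr (.inr (.inr (.inl (i, j, l)))) => .b0 i j l
    | .inr (.inr (.inr (.inr (.inl (i, l))))) => .u1 i l
    | .inr (.inr (.inr (.inr (.inr (.inl (i, l)))))) => .u0 i l
    | .inr (.inr (.inr (.inr (.inr (.inr (.inl (i, j, l))))))) => .wj i j l
    | .inr (.inr (.inr (.inr (.inr (.inr (.inr (i, l))))))) => .w0 i l
  left_inv e := by cases e <;> rfl
  right_inv x := by rcases x with _ | _ | _ | _ | _ | _ | _ | _ <;> rfl

theorem numEdges_eq (n r s t : ℕ) :
    numEdges n r s t = n * (2 * (r * s) + 2 * (r * s * t) + 3 * t + r * t) := by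
  rw [numEdges, Fintype.card_congr (edgeEquiv n r s t)]
  simp only [Fintype.card_sum, Fintype.card_prod, Fintype.card_fin]
  ring

theorem le_numEdges (n r s t : ℕ) : n * (r * s * t) ≤ numEdges n r s t := by
  rw [numEdges_eq]
  gcongr
  omega

theorem numEdges_le (hr : 0 < r) (hs : 0 < s) (ht : 0 < t) :
    numEdges n r s t ≤ 8 * (n * (r * s * t)) := by
  rw [numEdges_eq]
  have h1 : r * s ≤ r * s * t := Nat.le_mul_of_pos_right _ ht
  have h2 : t ≤ r * s * t := Nat.le_mul_of_pos_left _ (Nat.mul_pos hr hs)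
  have h3 : r * t ≤ r * s * t := Nat.mul_le_mul_right _ (Nat.le_mul_of_pos_right _ hs)
  calc n * (2 * (r * s) + 2 * (r * s * t) + 3 * t + r * t) ≤ n * (8 * (r * s * t)) := by
        gcongr
        omega
    _ = _ := by ring

theorem card_multiEdge_le (ht : 0 < t) : Fintype.card (MultiEdge n r s) ≤ numEdges n r s t := by
  refine Fintype.card_le_of_injective (fun m => m.copy (⟨0, ht⟩ : Fin t)) fun m m' h => ?_
  cases m <;> cases m' <;> simp_all [MultiEdge.copy]

theorem copyWeight_univ (p : ℝ) :
    copyWeight p (Finset.univ : Finset (CEdge n r s t)) =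
      Fintype.card (MultiEdge n r s) * p ^ t := by
  simp [copyWeight, copies]

theorem pathWeight_univ (p : ℝ) :
    pathWeight p Finset.univ (Finset.univ : Finset (CEdge n r s t)) = n * p ^ r := by
  simp [pathWeight, freePaths, APath]

/-- This is the counting bound at the start: all levels active, none lost, and two bits to count in
the first generation. -/
theorem Params.le_one_add_expectedSwitches (P : Params n r s t) {k : ℕ}
    (hN : (P.g : ℝ) * (k + 1) + P.S ≤ n) {B₀ : Finset (CEdge n r s t)}
    (hB : (counterGraph n r s t).IsTree B₀) (h0 : ∀ e ∈ B₀, e.IsZero) :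
    ENNReal.ofReal (2 ^ (k + 1) * (1 - P.K ^ (2 * (k + 1)) * (1 / 4 + n * P.p ^ r +
      P.η ^ (r * (k + 1)) * (Fintype.card (MultiEdge n r s) * P.p ^ t)))) ≤
      1 + expectedSwitches (counterGraph n r s t) Finset.univ B₀ := by
  have h := (P.bound hB (Finset.subset_univ _)).1 n Finset.univ k 2 0 (counting_univ h0) le_rfl
    (by simpa using hN)
  rw [countingValue, pathWeight_univ, copyWeight_univ] at h
  convert h using 2
  push_cast
  ring

/-- Bernoulli's inequality for the reciprocal. -/
theorem inv_one_sub_pow_le_two {x : ℝ} (hx1 : x < 1) {N : ℕ}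
    (h : 2 * (N * x) ≤ 1) : ((1 - x)⁻¹) ^ N ≤ 2 := by
  rw [inv_pow]
  refine inv_le_of_inv_le₀ (by norm_num) ?_
  have h1 := one_add_mul_le_pow (a := -x) (by linarith) N
  rw [← sub_eq_add_neg] at h1
  linarith

theorem inv_one_sub_pow_le_exp {z : ℝ} (hz0 : 0 ≤ z) (hz1 : z ≤ 1 / 2) (N : ℕ) :
    ((1 - z)⁻¹) ^ N ≤ Real.exp (N * (2 * z)) := by
  have h1 : (1 - z)⁻¹ ≤ Real.exp (2 * z) := by
    refine le_trans ?_ (Real.add_one_le_exp _)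
    rw [inv_le_iff_one_le_mul₀ (by linarith)]
    nlinarith
  rw [Real.exp_nat_mul]
  have : 0 ≤ (1 - z)⁻¹ := inv_nonneg.2 (by linarith)
  gcongr

theorem exp_neg_pow_le {C : ℝ} (hC0 : 0 < C) (hn0 : (0 : ℝ) < n) {q : ℕ}
    (hq : C⁻¹ * Real.log n ≤ q) : Real.exp (-(8 * C)) ^ q ≤ ((n : ℝ) ^ 8)⁻¹ := by
  have h1 : (n : ℝ) ^ 8 = Real.exp (8 * Real.log n) := by
    rw [mul_comm, Real.exp_mul, Real.exp_log hn0]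
    norm_cast
  rw [← Real.exp_nat_mul, h1, ← Real.exp_neg]
  refine Real.exp_le_exp.2 ?_
  have h2 : C * (C⁻¹ * Real.log n) ≤ C * q := by gcongr
  rw [mul_inv_cancel_left₀ hC0.ne'] at h2
  linarith

set_option maxHeartbeats 800000 in
/-- The bound for the number of switches, in terms of constants for the growth rates. -/
theorem two_pow_le_one_add_expectedSwitches {C p A : ℝ} (hC : 1 ≤ C) (hp : p = Real.exp (-(8 * C)))
    {m : ℕ} (hm : 4 * (16 + 2 * p⁻¹) ≤ m) (hAm : 2 * m ≤ A ^ 2) (hA : 2 * C ^ 3 * p⁻¹ ≤ A)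
    (hA1 : 1 ≤ A) (hn : A ≤ Real.sqrt n) (hnC : 2 * C ^ 2 * p⁻¹ ≤ Real.sqrt n)
    (hL : C ≤ Real.log n)
    (hr1 : C⁻¹ * Real.log n ≤ r) (hr2 : r ≤ C * Real.log n)
    (hs1 : C⁻¹ * (Real.sqrt n * Real.log n) ≤ s)
    (ht1 : C⁻¹ * Real.log n ≤ t) (ht2 : t ≤ C * Real.log n)
    (hM : (numEdges n r s t : ℝ) ≤ n ^ 3) {B₀ : Finset (CEdge n r s t)}
    (hB : (counterGraph n r s t).IsTree B₀) (h0 : ∀ e ∈ B₀, e.IsZero) :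
    ENNReal.ofReal (2 ^ ⌊Real.sqrt n / A⌋₊ / 4) ≤
      1 + expectedSwitches (counterGraph n r s t) Finset.univ B₀ := by
  have hC0 : 0 < C := by linarith
  have hp0 : 0 < p := hp ▸ Real.exp_pos _
  have hp1 : p ≤ 1 := by
    rw [hp]
    exact Real.exp_le_one_iff.2 (by linarith)
  have hpi : 1 ≤ p⁻¹ := (one_le_inv₀ hp0).2 hp1
  have hL0 : 0 < Real.log n := by linarith
  have hsq0 : 0 < Real.sqrt n := by linarith
  have hn0 : (0 : ℝ) < n := Real.sqrt_pos.1 hsq0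
  have hsq : Real.sqrt n ^ 2 = n := Real.sq_sqrt hn0.le
  have hC2 : 1 ≤ C⁻¹ * Real.log n := by
    rw [inv_mul_eq_div, one_le_div hC0]
    exact hL
  have hr0 : 0 < r := by
    have : (1 : ℝ) ≤ r := hC2.trans hr1
    exact_mod_cast this
  have ht0 : 0 < t := by
    have : (1 : ℝ) ≤ t := hC2.trans ht1
    exact_mod_cast this
  -- the ratio of `t` and `s` is small
  have hts : t * p⁻¹ * 2 ≤ s := by
    calc t * p⁻¹ * 2 ≤ C * Real.log n * p⁻¹ * 2 := by gcongr
      _ = C⁻¹ * ((2 * C ^ 2 * p⁻¹) * Real.log n) := by field_simp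
      _ ≤ C⁻¹ * (Real.sqrt n * Real.log n) := by gcongr
      _ ≤ s := hs1
  have ht0' : (0 : ℝ) < t := by exact_mod_cast ht0
  have hs0' : (0 : ℝ) < s := lt_of_lt_of_le (by positivity) hts
  have hs0 : 0 < s := by exact_mod_cast hs0'
  have hrs : 0 < r * s := Nat.mul_pos hr0 hs0
  have htrs : (t : ℝ) ≤ (r * s : ℕ) := by
    have h1 : (t : ℝ) ≤ s := by nlinarith
    have h2 : (s : ℝ) ≤ (r * s : ℕ) := by exact_mod_cast Nat.le_mul_of_pos_left s hr0
    exact h1.trans h2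
  obtain ⟨k, hk⟩ : ∃ k, ⌊Real.sqrt n / A⌋₊ = k + 1 := by
    refine Nat.exists_eq_succ_of_ne_zero (Nat.floor_pos.2 ?_).ne'
    rw [one_le_div (by linarith)]
    exact hn
  have hk' : ((k + 1 : ℕ) : ℝ) * A ≤ Real.sqrt n := by
    rw [← hk, ← le_div_iff₀ (by linarith)]
    exact Nat.floor_le (by positivity)
  set μ := 16 + 2 * p⁻¹ with hμ
  have hμ0 : 0 < μ := by positivity
  have hm0 : (0 : ℝ) < m := by linarith
  have hk0 : (0 : ℝ) < (k + 1 : ℕ) := by positivity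
  have hg0 : (0 : ℝ) < ((m * (k + 1) : ℕ) : ℝ) := by
    rw [Nat.cast_mul]
    positivity
  have hμg : 4 * (k + 1 : ℕ) * (μ / (m * (k + 1) : ℕ)) ≤ 1 := by
    rw [Nat.cast_mul, mul_div_assoc', div_le_one (by positivity)]
    nlinarith
  have hμg4 : μ / (m * (k + 1) : ℕ) ≤ 1 / 4 := by
    have h1 : (1 : ℝ) ≤ (k + 1 : ℕ) := by exact_mod_cast Nat.succ_pos k
    have h2 : 0 < μ / (m * (k + 1) : ℕ) := by positivity
    nlinarith
  set z := t * p⁻¹ / s with hz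
  have hz0 : 0 ≤ z := by positivity
  have hz1 : z ≤ 1 / 2 := by
    rw [hz, div_le_iff₀ hs0']
    linarith
  have hμg0 : 0 < μ / (m * (k + 1) : ℕ) := by positivity
  -- `S = n / 4` makes `4 * n / S = 16`, and `t ≤ r * s` bounds the other losses by `2 * p⁻¹ * (r *
  -- s)`. So counting needs `g * (1 - K⁻¹) ≥ μ`, and `K` is chosen with equality. Likewise `η` gives
  -- equality in `setting_drift`.
  let P : Params n r s t :=
    { p := p
      K := (1 - μ / (m * (k + 1) : ℕ))⁻¹
      η := (1 - z)⁻¹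
      S := n / 4
      g := m * (k + 1)
      p_pos := hp0
      p_le := hp1
      one_le_K := (one_le_inv₀ (by linarith)).2 (by linarith)
      one_le_η := (one_le_inv₀ (by linarith)).2 (by linarith)
      S_pos := by positivity
      g_pos := by exact_mod_cast hg0
      rs_pos := hrs
      counting_drift := by
        have h1 : 4 * (n : ℝ) / (n / 4) = 16 := by
          field_simp
          norm_num
        have h2 : ((m * (k + 1) : ℕ) : ℝ) * (r * s : ℕ) * (1 - (1 - μ / (m * (k + 1) : ℕ))⁻¹⁻¹) =
            μ * (r * s : ℕ) := by
          rw [inv_inv]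
          field_simp
          ring
        rw [h1, h2, hμ]
        have := mul_le_mul_of_nonneg_right htrs (by positivity : 0 ≤ p⁻¹)
        linarith
      setting_drift := by
        rw [inv_inv, hz]
        apply le_of_eq
        field_simp
        ring }
  have hmain := P.le_one_add_expectedSwitches (k := k) ?_ hB h0
  swap
  -- From `(k + 1) * A ≤ √n` and `2 * m ≤ A ^ 2`, the counted generations use at most `n / 2`
  -- levels; `n / 4` are kept as slack.
  · change ((m * (k + 1) : ℕ) : ℝ) * (k + 1) + (n : ℝ) / 4 ≤ n
    have h1 : (((k + 1 : ℕ) : ℝ) * A) ^ 2 ≤ n := by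
      rw [← hsq]
      gcongr
    rw [mul_pow] at h1
    have h2 : ((k + 1 : ℕ) : ℝ) ^ 2 * (2 * m) ≤ ((k + 1 : ℕ) : ℝ) ^ 2 * A ^ 2 := by gcongr
    push_cast at h1 h2 ⊢
    linarith
  rw [hk]
  refine le_trans (ENNReal.ofReal_le_ofReal ?_) hmain
  have hpow : ∀ q : ℕ, C⁻¹ * Real.log n ≤ q → p ^ q ≤ ((n : ℝ) ^ 8)⁻¹ := by
    intro q hq
    rw [hp]
    exact exp_neg_pow_le hC0 hn0 hq
  have hn2 : (2 : ℝ) ≤ n := by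
    have h1 : 1 ≤ C ^ 2 * p⁻¹ := one_le_mul_of_one_le_of_one_le (one_le_pow₀ hC) hpi
    have h2 : (2 : ℝ) ≤ Real.sqrt n := by linarith
    calc (2 : ℝ) ≤ 2 ^ 2 := by norm_num
      _ ≤ Real.sqrt n ^ 2 := by gcongr
      _ = n := hsq
  have hK : P.K ^ (2 * (k + 1)) ≤ 2 := by
    refine inv_one_sub_pow_le_two (by linarith) ?_
    rw [Nat.cast_mul 2]
    push_cast at hμg ⊢
    linarith
  -- Here the size of `s` matters: `z` is at most of order `1 / √n` and there are at most of order
  -- `√n log n / A` factors, so a large `A` brings the exponent below `log n`.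
  have hη : P.η ^ (r * (k + 1)) ≤ n := by
    refine (inv_one_sub_pow_le_exp hz0 hz1 _).trans ?_
    rw [← Real.le_log_iff_exp_le hn0, Nat.cast_mul]
    have h3 : (r : ℝ) * (k + 1 : ℕ) * (2 * (t * p⁻¹)) * A ≤ s * Real.log n * A := by
      calc (r : ℝ) * (k + 1 : ℕ) * (2 * (t * p⁻¹)) * A
          = r * (2 * (t * p⁻¹)) * ((k + 1 : ℕ) * A) := by ring
        _ ≤ (C * Real.log n) * (2 * ((C * Real.log n) * p⁻¹)) * Real.sqrt n := by gcongr
        _ = C⁻¹ * (Real.sqrt n * Real.log n) * Real.log n * (2 * C ^ 3 * p⁻¹) := by field_simp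
        _ ≤ s * Real.log n * A := by gcongr
    have h4 := le_of_mul_le_mul_right h3 (by linarith)
    rw [hz]
    calc (r : ℝ) * (k + 1 : ℕ) * (2 * (t * p⁻¹ / s)) =
        (r : ℝ) * (k + 1 : ℕ) * (2 * (t * p⁻¹)) / s := by ring
      _ ≤ Real.log n := by
        rw [div_le_iff₀ hs0']
        linarith
  have hcard : (Fintype.card (MultiEdge n r s) : ℝ) ≤ n ^ 3 :=
    le_trans (by exact_mod_cast card_multiEdge_le ht0) hM
  have hn16 : (16 : ℝ) ≤ n ^ 4 := by
    calc (16 : ℝ) = 2 ^ 4 := by norm_num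
      _ ≤ n ^ 4 := by gcongr
  have hw1 : n * P.p ^ r ≤ 1 / 16 := by
    calc (n : ℝ) * p ^ r ≤ n * ((n : ℝ) ^ 8)⁻¹ := by
          gcongr
          exact hpow r hr1
      _ = ((n : ℝ) ^ 4 * n ^ 3)⁻¹ := by field_simp
      _ ≤ (16 * 1)⁻¹ := by
          gcongr
          exact one_le_pow₀ (by linarith)
      _ = 1 / 16 := by norm_num
  have hw2 : P.η ^ (r * (k + 1)) * (Fintype.card (MultiEdge n r s) * P.p ^ t) ≤ 1 / 16 := by
    have hpt : P.p ^ t ≤ ((n : ℝ) ^ 8)⁻¹ := hpow t ht1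
    have hpt0 : 0 ≤ P.p ^ t := by
      have := P.p_pos
      positivity
    calc P.η ^ (r * (k + 1)) * (Fintype.card (MultiEdge n r s) * P.p ^ t)
        ≤ n * (n ^ 3 * ((n : ℝ) ^ 8)⁻¹) := by gcongr
      _ = ((n : ℝ) ^ 4)⁻¹ := by field_simp
      _ ≤ 16⁻¹ := by gcongr
      _ = 1 / 16 := by norm_num
  have hK0 : 0 ≤ P.K ^ (2 * (k + 1)) := pow_nonneg (zero_le_one.trans P.one_le_K) _
  -- The initial discount is at most `2 * (1 / 4 + 1 / 16 + 1 / 16) = 3 / 4`, which leaves a quarter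
  -- of `2 ^ (k + 1)`.
  have hfin : P.K ^ (2 * (k + 1)) * (1 / 4 + n * P.p ^ r +
      P.η ^ (r * (k + 1)) * (Fintype.card (MultiEdge n r s) * P.p ^ t)) ≤ 2 * (3 / 8) := by
    calc _ ≤ P.K ^ (2 * (k + 1)) * (3 / 8) := by
          gcongr
          linarith
      _ ≤ _ := by gcongr
  have h2k : (0 : ℝ) ≤ 2 ^ (k + 1) := by positivity
  rw [div_eq_mul_one_div]
  refine mul_le_mul_of_nonneg_left ?_ h2k
  linarith

end CounterGraph

/-! ### Asymptotic growth and the final estimate. -/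

/-- The bounds hold for all sufficiently large `C`, so one constant can serve `r`, `s` and `t`
together. -/
theorem Asymptotics.IsTheta.exists_bounds {f g : ℕ → ℝ} (h : f =Θ[atTop] g)
    (hf : ∀ n, 0 ≤ f n) (hg : ∀ n, 0 ≤ g n) :
    ∃ C₀ : ℝ, ∀ C ≥ C₀, 0 < C → ∀ᶠ n in atTop, C⁻¹ * g n ≤ f n ∧ f n ≤ C * g n := by
  obtain ⟨c₁, h₁⟩ := h.1.bound
  obtain ⟨c₂, h₂⟩ := h.2.bound
  refine ⟨max c₁ c₂, fun C hC hC0 => ?_⟩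
  filter_upwards [h₁, h₂] with n h₁ h₂
  rw [Real.norm_of_nonneg (hf n), Real.norm_of_nonneg (hg n)] at h₁ h₂
  have h1 : c₁ * g n ≤ C * g n :=
    mul_le_mul_of_nonneg_right ((le_max_left _ _).trans hC) (hg n)
  have h2 : c₂ * f n ≤ C * f n :=
    mul_le_mul_of_nonneg_right ((le_max_right _ _).trans hC) (hf n)
  refine ⟨?_, h₁.trans h1⟩
  rw [inv_mul_le_iff₀ hC0]
  linarith

namespace CounterGraph

variable {n r s t : ℕ}

/-- Bounds for the number of edges, in terms of constants for the growth rates. -/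
theorem numEdges_bounds {C : ℝ} (hC : 1 ≤ C) (hL : C ≤ Real.log n)
    (hLn : 2 * C * Real.log n ≤ Real.sqrt n)
    (hr : C⁻¹ * Real.log n ≤ r ∧ r ≤ C * Real.log n)
    (hs : C⁻¹ * (Real.sqrt n * Real.log n) ≤ s ∧ s ≤ C * (Real.sqrt n * Real.log n))
    (ht : C⁻¹ * Real.log n ≤ t ∧ t ≤ C * Real.log n) :
    (numEdges n r s t : ℝ) ≤ n ^ 3 ∧
    (3 * C)⁻¹ * Real.sqrt n ≤
      (numEdges n r s t : ℝ) ^ (1 / 3 : ℝ) / Real.log (numEdges n r s t) ∧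
    (numEdges n r s t : ℝ) ^ (1 / 3 : ℝ) / Real.log (numEdges n r s t) ≤
      2 * C * Real.sqrt n := by
  have hC0 : 0 < C := by linarith
  have hL0 : 0 < Real.log n := by linarith
  have hsq0 : 0 < Real.sqrt n := lt_of_lt_of_le (by positivity) hLn
  have hn0 : (0 : ℝ) < n := Real.sqrt_pos.1 hsq0
  have hsq : Real.sqrt n ^ 2 = n := Real.sq_sqrt hn0.le
  have hC2 : 1 ≤ C⁻¹ * Real.log n := by
    rw [inv_mul_eq_div, one_le_div hC0]
    exact hL
  have hsq1 : 1 ≤ Real.sqrt n := by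
    refine le_trans ?_ hLn
    have : 1 ≤ C * Real.log n := one_le_mul_of_one_le_of_one_le hC (hC.trans hL)
    linarith
  have hr1 : (1 : ℝ) ≤ r := hC2.trans hr.1
  have ht1 : (1 : ℝ) ≤ t := hC2.trans ht.1
  have hs1 : (1 : ℝ) ≤ s := by
    refine le_trans ?_ hs.1
    calc (1 : ℝ) ≤ Real.sqrt n * (C⁻¹ * Real.log n) := one_le_mul_of_one_le_of_one_le hsq1 hC2
      _ = _ := by ring
  set M := (numEdges n r s t : ℝ) with hMdef
  have hlow : (n : ℝ) * (r * s * t) ≤ M := by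
    rw [hMdef]
    exact_mod_cast le_numEdges n r s t
  have hup : M ≤ 8 * (n * (r * s * t)) := by
    rw [hMdef]
    exact_mod_cast numEdges_le (n := n) (by exact_mod_cast hr1 : 0 < r)
      (by exact_mod_cast hs1 : 0 < s) (by exact_mod_cast ht1 : 0 < t)
  have hlow3 : (C⁻¹ * (Real.sqrt n * Real.log n)) ^ 3 ≤ M := by
    refine le_trans ?_ hlow
    calc (C⁻¹ * (Real.sqrt n * Real.log n)) ^ 3 = Real.sqrt n ^ 2 *
          ((C⁻¹ * Real.log n) * (C⁻¹ * (Real.sqrt n * Real.log n)) * (C⁻¹ * Real.log n)) := by ring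
      _ ≤ (n : ℝ) * (r * s * t) := by
        rw [hsq]
        have := hr.1
        have := hs.1
        have := ht.1
        gcongr
  have hup3 : M ≤ (2 * C * (Real.sqrt n * Real.log n)) ^ 3 := by
    refine hup.trans ?_
    calc 8 * ((n : ℝ) * (r * s * t)) ≤ 8 * (Real.sqrt n ^ 2 *
          ((C * Real.log n) * (C * (Real.sqrt n * Real.log n)) * (C * Real.log n))) := by
          rw [hsq]
          have := hr.2
          have := hs.2
          have := ht.2
          gcongr
      _ = _ := by ring
  have hM3 : M ≤ n ^ 3 := by
    refine hup3.trans ?_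
    have : 2 * C * (Real.sqrt n * Real.log n) ≤ n := by
      calc 2 * C * (Real.sqrt n * Real.log n) = Real.sqrt n * (2 * C * Real.log n) := by ring
        _ ≤ Real.sqrt n * Real.sqrt n := by gcongr
        _ = n := by rw [← sq, hsq]
    gcongr
  have hnM : (n : ℝ) ≤ M := by
    refine le_trans ?_ hlow
    refine le_mul_of_one_le_right hn0.le ?_
    exact one_le_mul_of_one_le_of_one_le (one_le_mul_of_one_le_of_one_le hr1 hs1) ht1
  have hM0 : 0 < M := hn0.trans_le hnM
  have hlog1 : Real.log n ≤ Real.log M := Real.log_le_log hn0 hnM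
  have hlog2 : Real.log M ≤ 3 * Real.log n := by
    have := Real.log_le_log hM0 hM3
    rwa [Real.log_pow] at this
  have hcube : ∀ x : ℝ, 0 ≤ x → (x ^ 3) ^ (1 / 3 : ℝ) = x := by
    intro x hx
    rw [← Real.rpow_natCast, ← Real.rpow_mul hx]
    norm_num
  have hroot1 : C⁻¹ * (Real.sqrt n * Real.log n) ≤ M ^ (1 / 3 : ℝ) := by
    have := Real.rpow_le_rpow (by positivity) hlow3 (by norm_num : (0 : ℝ) ≤ 1 / 3)
    rwa [hcube _ (by positivity)] at this
  have hroot2 : M ^ (1 / 3 : ℝ) ≤ 2 * C * (Real.sqrt n * Real.log n) := by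
    have := Real.rpow_le_rpow hM0.le hup3 (by norm_num : (0 : ℝ) ≤ 1 / 3)
    rwa [hcube _ (by positivity)] at this
  have hlogM : 0 < Real.log M := by linarith
  refine ⟨hM3, ?_, ?_⟩
  · rw [le_div_iff₀ hlogM]
    calc (3 * C)⁻¹ * Real.sqrt n * Real.log M ≤ (3 * C)⁻¹ * Real.sqrt n * (3 * Real.log n) := by
          gcongr
      _ = C⁻¹ * (Real.sqrt n * Real.log n) := by field_simp
      _ ≤ _ := hroot1
  · rw [div_le_iff₀ hlogM]
    calc M ^ (1 / 3 : ℝ) ≤ 2 * C * (Real.sqrt n * Real.log n) := hroot2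
      _ = 2 * C * Real.sqrt n * Real.log n := by ring
      _ ≤ _ := by gcongr

/-- Since `2 ≥ exp (1 / 2)`, the power of two is at least the exponential of almost twice the
required exponent. The surplus absorbs the rounding, the factor `1 / 4` and the summand `1` that
stems from bounding one plus the expectation. -/
theorem exp_add_one_le_two_pow_div {A x : ℝ} (hA : 1 ≤ A) (hx : 40 * A ≤ x) :
    Real.exp ((4 * A)⁻¹ * x) + 1 ≤ 2 ^ ⌊x / A⌋₊ / 4 := by
  have hA0 : 0 < A := by linarith
  set y := (4 * A)⁻¹ * x with hy
  have hxy : x / A = 4 * y := by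
    rw [hy]
    field_simp
  have hy10 : 10 ≤ y := by
    rw [hy, le_inv_mul_iff₀ (by positivity)]
    linarith
  have h1 : 4 * y - 1 ≤ (⌊x / A⌋₊ : ℝ) := by
    rw [hxy]
    linarith [Nat.lt_floor_add_one (4 * y)]
  have h2 : Real.exp (1 / 2) ≤ 2 := by
    rw [← Real.le_log_iff_exp_le two_pos]
    linarith [Real.log_two_gt_d9]
  have h3 : Real.exp ((⌊x / A⌋₊ : ℝ) * (1 / 2)) ≤ 2 ^ ⌊x / A⌋₊ := by
    rw [Real.exp_nat_mul]
    gcongr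
  have h4 : Real.exp (y + (y - 1 / 2)) ≤ Real.exp ((⌊x / A⌋₊ : ℝ) * (1 / 2)) :=
    Real.exp_le_exp.2 (by linarith)
  rw [Real.exp_add] at h4
  have h5 : 8 ≤ Real.exp (y - 1 / 2) := by linarith [Real.add_one_le_exp (y - 1 / 2)]
  have h6 : 1 ≤ Real.exp y := Real.one_le_exp (by linarith)
  have h7 : Real.exp y * 8 ≤ Real.exp y * Real.exp (y - 1 / 2) := by gcongr
  linarith

end CounterGraph

theorem theorem1 (r s t : ℕ → ℕ)
    (hr : (fun n : ℕ => (r n : ℝ)) =Θ[atTop] fun n : ℕ => Real.log n)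
    (hs : (fun n : ℕ => (s n : ℝ)) =Θ[atTop] fun n : ℕ => Real.sqrt n * Real.log n)
    (ht : (fun n : ℕ => (t n : ℝ)) =Θ[atTop] fun n : ℕ => Real.log n) :
    ((fun n : ℕ => Real.sqrt n) =Θ[atTop] fun n : ℕ =>
      (numEdges n (r n) (s n) (t n) : ℝ) ^ (1 / 3 : ℝ) /
        Real.log (numEdges n (r n) (s n) (t n))) ∧
    ∃ c : ℝ, 0 < c ∧ ∀ᶠ n : ℕ in atTop,
      ∀ B₀ : Finset (CEdge n (r n) (s n) (t n)),
        (counterGraph n (r n) (s n) (t n)).IsTree B₀ → (∀ e ∈ B₀, e.IsZero) →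
          ENNReal.ofReal (Real.exp (c * Real.sqrt n)) ≤
              expectedSwitches (counterGraph n (r n) (s n) (t n)) Finset.univ B₀ ∧
          ENNReal.ofReal (Real.exp (c *
              ((numEdges n (r n) (s n) (t n) : ℝ) ^ (1 / 3 : ℝ) /
                Real.log (numEdges n (r n) (s n) (t n))))) ≤
              expectedSwitches (counterGraph n (r n) (s n) (t n)) Finset.univ B₀ := by
  have hlog : ∀ n : ℕ, 0 ≤ Real.log n := Real.log_natCast_nonneg
  obtain ⟨C₁, h₁⟩ := hr.exists_bounds (fun n => by positivity) hlog
  obtain ⟨C₂, h₂⟩ := hs.exists_bounds (fun n => by positivity)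
    fun n => mul_nonneg (Real.sqrt_nonneg _) (hlog n)
  obtain ⟨C₃, h₃⟩ := ht.exists_bounds (fun n => by positivity) hlog
  obtain ⟨C, hC⟩ : ∃ C : ℝ, 1 ≤ C ∧ C₁ ≤ C ∧ C₂ ≤ C ∧ C₃ ≤ C :=
    ⟨max (max 1 C₁) (max C₂ C₃), by simp, by simp, by simp, by simp⟩
  obtain ⟨hC, hC₁, hC₂, hC₃⟩ := hC
  have hC0 : 0 < C := by linarith
  have hlogTop : Tendsto (fun n : ℕ => Real.log n) atTop atTop :=
    Real.tendsto_log_atTop.comp tendsto_natCast_atTop_atTop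
  have hsqrtTop : Tendsto (fun n : ℕ => Real.sqrt n) atTop atTop :=
    Real.tendsto_sqrt_atTop.comp tendsto_natCast_atTop_atTop
  have hlogSqrt : ∀ᶠ n : ℕ in atTop, 2 * C * Real.log n ≤ Real.sqrt n := by
    have h := (isLittleO_log_rpow_atTop (r := 1 / 2) (by norm_num)).comp_tendsto
      (tendsto_natCast_atTop_atTop (R := ℝ))
    filter_upwards [h.bound (c := (2 * C)⁻¹) (by positivity)] with n hn
    simp only [Function.comp_apply] at hn
    rw [Real.norm_of_nonneg (hlog n), Real.norm_of_nonneg (by positivity),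
      ← Real.sqrt_eq_rpow, le_inv_mul_iff₀ (by positivity)] at hn
    exact hn
  have hbounds := (h₁ C hC₁ hC0).and <| (h₂ C hC₂ hC0).and <| (h₃ C hC₃ hC0).and <|
    (hlogTop.eventually_ge_atTop C).and hlogSqrt
  constructor
  · constructor
    · refine IsBigO.of_bound (3 * C) ?_
      filter_upwards [hbounds] with n ⟨h1, h2, h3, hL, hLn⟩
      obtain ⟨-, h4, -⟩ := CounterGraph.numEdges_bounds hC hL hLn h1 h2 h3
      rw [Real.norm_of_nonneg (Real.sqrt_nonneg _)]
      rw [inv_mul_le_iff₀ (by positivity)] at h4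
      exact h4.trans (by gcongr; exact le_abs_self _)
    · refine IsBigO.of_bound (2 * C) ?_
      filter_upwards [hbounds] with n ⟨h1, h2, h3, hL, hLn⟩
      obtain ⟨-, h4, h5⟩ := CounterGraph.numEdges_bounds hC hL hLn h1 h2 h3
      rw [Real.norm_of_nonneg (Real.sqrt_nonneg _), Real.norm_of_nonneg]
      · exact h5
      · exact le_trans (by positivity) h4
  · set p := Real.exp (-(8 * C)) with hp
    have hp0 : 0 < p := Real.exp_pos _
    -- A large `m` keeps the total factor from `K` below `2`; `A` is then chosen large enough for
    -- the budget of levels and for the factor from `η`.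
    obtain ⟨m, hm⟩ := exists_nat_ge (4 * (16 + 2 * p⁻¹))
    obtain ⟨A, hA1, hA2, hAm⟩ : ∃ A : ℝ, 1 ≤ A ∧ 2 * C ^ 3 * p⁻¹ ≤ A ∧ 2 * m ≤ A :=
      ⟨max 1 (max (2 * C ^ 3 * p⁻¹) (2 * m)), by simp, by simp, by simp⟩
    have hA0 : 0 < A := by linarith
    -- The divisor `2 * C` converts the bound in `√n` into one in `M ^ (1 / 3) / log M`, which is at
    -- most `2 * C * √n`.
    refine ⟨(4 * A)⁻¹ / (2 * C), by positivity, ?_⟩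
    filter_upwards [hbounds, hsqrtTop.eventually_ge_atTop (40 * A),
      hsqrtTop.eventually_ge_atTop (2 * C ^ 2 * p⁻¹)] with n ⟨h1, h2, h3, hL, hLn⟩ hn40 hnC
    intro B₀ hB h0
    obtain ⟨hM, -, hM2⟩ := CounterGraph.numEdges_bounds hC hL hLn h1 h2 h3
    have hmain := CounterGraph.two_pow_le_one_add_expectedSwitches hC hp hm
      (hAm.trans (by nlinarith)) hA2 hA1 (by linarith) hnC hL h1.1 h1.2 h2.1 h3.1 h3.2 hM hB h0
    have hE : ENNReal.ofReal (Real.exp ((4 * A)⁻¹ * Real.sqrt n)) ≤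
        expectedSwitches (counterGraph n (r n) (s n) (t n)) Finset.univ B₀ := by
      have h5 := (ENNReal.ofReal_le_ofReal
        (CounterGraph.exp_add_one_le_two_pow_div hA1 hn40)).trans hmain
      rw [ENNReal.ofReal_add (Real.exp_pos _).le zero_le_one, ENNReal.ofReal_one, add_comm] at h5
      exact (ENNReal.add_le_add_iff_left ENNReal.one_ne_top).1 h5
    refine ⟨le_trans (ENNReal.ofReal_le_ofReal (Real.exp_le_exp.2 ?_)) hE,
      le_trans (ENNReal.ofReal_le_ofReal (Real.exp_le_exp.2 ?_)) hE⟩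
    · gcongr
      exact div_le_self (by positivity) (by linarith)
    · calc (4 * A)⁻¹ / (2 * C) * ((numEdges n (r n) (s n) (t n) : ℝ) ^ (1 / 3 : ℝ) /
            Real.log (numEdges n (r n) (s n) (t n))) ≤
          (4 * A)⁻¹ / (2 * C) * (2 * C * Real.sqrt n) := by gcongr
        _ = (4 * A)⁻¹ * Real.sqrt n := by field_simp
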